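/- Let $n\in\mathbb Z_{+}$ and let $\mathfrak g=\mathfrak q(n)$ be the queer Lie superalgebra of complex block matrices $\begin{pmatrix}A&B\\B&A\end{pmatrix}$ with $A,B$ of size $n\times n$; the part with $B=0$ is even and the part with $A=0$ is odd. Let $\mathfrak h=\mathfrak h_{\bar 0}\oplus\mathfrak h_{\bar 1}$ be the Cartan subalgebra where $A,B$ are diagonal, let $\mathfrak n^+$ be the subalgebra where $A,B$ are strictly upper triangular, and put $\mathfrak b=\mathfrak h\oplus\mathfrak n^+$. Write $\lambda\in\mathfrak h_{\bar 0}^*$ as $\lambda=\sum_{i=1}^n\lambda_i\delta_i$, where $\delta_1,\dots,\delta_n$ is the basis dual to the standard basis of $\mathfrak h_{\bar 0}$, and let $\Phi^+=\{\delta_i-\delta_j: i<j\}$. For each $\lambda\in\mathfrak h_{\bar 0}^*$ choose a maximal isotropic subspace $\mathfrak h'_{\bar 1}\subseteq\mathfrak h_{\bar 1}$ for the form $\langle H,H'\rangle_\lambda=\lambda([H,H'])$. Let $I_\lambda$ be the $\mathfrak h$-module induced from the one-dimensional even $(\mathfrak h_{\bar 0}\oplus\mathfrak h'_{\bar 1})$-module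 on which $\mathfrak h_{\bar 0}$ acts by $\lambda$ and $\mathfrak h'_{\bar 1}$ by $0$. Let $\mathfrak n^+$ act on $I_\lambda$ by $0$, let $\Delta(\lambda)=\mathrm{Ind}_{\mathfrak b}^{\mathfrak g}I_\lambda$ be the Verma module, and let $L(\lambda)$ be its unique irreducible ($\mathbb Z_2$-graded) quotient. For a $\mathbb Z_2$-graded $\mathfrak g$-module $M$ with weight spaces $M_\mu=M_{\mu,\bar 0}\oplus M_{\mu,\bar 1}$ with respect to $\mathfrak h_{\bar 0}$, all finite-dimensional, put $$\mathrm{sch}\,M=\sum_{\mu\in\mathfrak h_{\bar 0}^*}\left(\dim M_{\mu,\bar 0}-\dim M_{\mu,\bar 1}\right)e^{\mu}.$$ Let $\chi_\lambda$ be the central character of $L(\lambda)$, i.e. the character by which the (even) center of $U(\mathfrak g)$ acts on $L(\lambda)$. Write $\lambda\succeq\mu$ if $\chi_\lambda=\chi_\mu$ and $\lambda-\mu\in\sum_{\alpha\in\Phi^+}\mathbb Z_{+}\alpha$. Then, for every $\lambda\in\mathfrak h_{\bar 0}^*$, the weight spaces of $L(\lambda)$ are finite-dimensional and $\mathrm{sch}\,L(\lambda)\in\mathbb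 Z=\mathbb Z e^0$; that is, $\mathrm{sch}\,L(\lambda)$ is an integer constant. If $\lambda\not\succeq 0$, then $\mathrm{sch}\,L(\lambda)=0$. In particular, $\mathrm{sch}\,L(\lambda)=0$ whenever some $\lambda_i$ is not an integer. -/

import Mathlib

namespace Queer

/-- The underlying superspace of the queer Lie superalgebra `q(n)`: the pair `(A, B)` of `n × n`
complex matrices stands for the block matrix `[A, B; B, A]` in `gl(n|n)`. -/
abbrev Q (n : ℕ) : Type := Matrix (Fin n) (Fin n) ℂ × Matrix (Fin n) (Fin n) ℂ

/-- The block matrix `[A, B; B, A]` in `gl(n|n)`. -/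
def toBlock {n : ℕ} (x : Q n) : Matrix (Fin n ⊕ Fin n) (Fin n ⊕ Fin n) ℂ :=
  Matrix.fromBlocks x.1 x.2 x.2 x.1

/-- The even element `[A, 0; 0, A]`. -/
def ev {n : ℕ} (A : Matrix (Fin n) (Fin n) ℂ) : Q n := (A, 0)

/-- The odd element `[0, B; B, 0]`. -/
def od {n : ℕ} (B : Matrix (Fin n) (Fin n) ℂ) : Q n := (0, B)

/-- The Lie superbracket of `q(n)`, the restriction of the supercommutator of `gl(n|n)`
(see the three lemmas below). -/
def superBracket {n : ℕ} (x y : Q n) : Q n :=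
  (x.1 * y.1 - y.1 * x.1 + (x.2 * y.2 + y.2 * x.2),
   x.1 * y.2 - y.2 * x.1 + (x.2 * y.1 - y.1 * x.2))

theorem toBlock_superBracket_ev_ev {n : ℕ} (A A' : Matrix (Fin n) (Fin n) ℂ) :
    toBlock (superBracket (ev A) (ev A')) =
      toBlock (ev A) * toBlock (ev A') - toBlock (ev A') * toBlock (ev A) := by
  simp [toBlock, superBracket, ev, Matrix.fromBlocks_multiply, sub_eq_add_neg,
    Matrix.fromBlocks_neg, Matrix.fromBlocks_add]

theorem toBlock_superBracket_ev_od {n : ℕ} (A B : Matrix (Fin n) (Fin n) ℂ) :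
    toBlock (superBracket (ev A) (od B)) =
      toBlock (ev A) * toBlock (od B) - toBlock (od B) * toBlock (ev A) := by
  simp [toBlock, superBracket, ev, od, Matrix.fromBlocks_multiply, sub_eq_add_neg,
    Matrix.fromBlocks_neg, Matrix.fromBlocks_add]

theorem toBlock_superBracket_od_od {n : ℕ} (B B' : Matrix (Fin n) (Fin n) ℂ) :
    toBlock (superBracket (od B) (od B')) =
      toBlock (od B) * toBlock (od B') + toBlock (od B') * toBlock (od B) := by
  simp [toBlock, superBracket, od, Matrix.fromBlocks_multiply, Matrix.fromBlocks_add]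

/-- The defining relations `x y - (-1)^{|x||y|} y x = [x, y]` (`x`, `y` homogeneous) of the
universal enveloping superalgebra. The case `x` odd, `y` even follows from `x` even, `y` odd. -/
inductive Rel (n : ℕ) : TensorAlgebra ℂ (Q n) → TensorAlgebra ℂ (Q n) → Prop
  | ev_ev (A A' : Matrix (Fin n) (Fin n) ℂ) : Rel n
      (TensorAlgebra.ι ℂ (ev A) * TensorAlgebra.ι ℂ (ev A') -
        TensorAlgebra.ι ℂ (ev A') * TensorAlgebra.ι ℂ (ev A))
      (TensorAlgebra.ι ℂ (superBracket (ev A) (ev A')))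
  | ev_od (A B : Matrix (Fin n) (Fin n) ℂ) : Rel n
      (TensorAlgebra.ι ℂ (ev A) * TensorAlgebra.ι ℂ (od B) -
        TensorAlgebra.ι ℂ (od B) * TensorAlgebra.ι ℂ (ev A))
      (TensorAlgebra.ι ℂ (superBracket (ev A) (od B)))
  | od_od (B B' : Matrix (Fin n) (Fin n) ℂ) : Rel n
      (TensorAlgebra.ι ℂ (od B) * TensorAlgebra.ι ℂ (od B') +
        TensorAlgebra.ι ℂ (od B') * TensorAlgebra.ι ℂ (od B))
      (TensorAlgebra.ι ℂ (superBracket (od B) (od B')))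

/-- The universal enveloping superalgebra `U(q(n))`. -/
def U (n : ℕ) : Type := RingQuot (Rel n)

noncomputable instance (n : ℕ) : Ring (U n) := inferInstanceAs (Ring (RingQuot (Rel n)))

noncomputable instance (n : ℕ) : Algebra ℂ (U n) :=
  inferInstanceAs (Algebra ℂ (RingQuot (Rel n)))

/-- The quotient map from the tensor algebra to `U(q(n))`. -/
noncomputable def mkU (n : ℕ) : TensorAlgebra ℂ (Q n) →ₐ[ℂ] U n :=
  RingQuot.mkAlgHom ℂ (Rel n)

/-- The canonical map `q(n) → U(q(n))`. -/
noncomputable def incl (n : ℕ) : Q n →ₗ[ℂ] U n :=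
  (mkU n).toLinearMap ∘ₗ TensorAlgebra.ι ℂ

/-- The parity involution `x ↦ (-1)^{|x|} x` of `q(n)`. -/
def parityQ (n : ℕ) : Q n →ₗ[ℂ] Q n where
  toFun x := (x.1, -x.2)
  map_add' x y := by ext <;> simp [add_comm]
  map_smul' c x := by ext <;> simp

theorem incl_ev_ev {n : ℕ} (A A' : Matrix (Fin n) (Fin n) ℂ) :
    incl n (ev A) * incl n (ev A') - incl n (ev A') * incl n (ev A) =
      incl n (superBracket (ev A) (ev A')) := by
  have h : mkU n _ = mkU n _ := RingQuot.mkAlgHom_rel ℂ (Rel.ev_ev A A')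
  simp only [map_sub, map_mul] at h
  exact h

theorem incl_ev_od {n : ℕ} (A B : Matrix (Fin n) (Fin n) ℂ) :
    incl n (ev A) * incl n (od B) - incl n (od B) * incl n (ev A) =
      incl n (superBracket (ev A) (od B)) := by
  have h : mkU n _ = mkU n _ := RingQuot.mkAlgHom_rel ℂ (Rel.ev_od A B)
  simp only [map_sub, map_mul] at h
  exact h

theorem incl_od_od {n : ℕ} (B B' : Matrix (Fin n) (Fin n) ℂ) :
    incl n (od B) * incl n (od B') + incl n (od B') * incl n (od B) =
      incl n (superBracket (od B) (od B')) := by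
  have h : mkU n _ = mkU n _ := RingQuot.mkAlgHom_rel ℂ (Rel.od_od B B')
  simp only [map_add, map_mul] at h
  exact h

theorem lift_rel {n : ℕ} {x y : TensorAlgebra ℂ (Q n)} (h : Rel n x y) :
    TensorAlgebra.lift ℂ (incl n ∘ₗ parityQ n) x =
      TensorAlgebra.lift ℂ (incl n ∘ₗ parityQ n) y := by
  have hev : ∀ A : Matrix (Fin n) (Fin n) ℂ, parityQ n (ev A) = ev A := fun A => by
    simp [parityQ, ev]
  have hod : ∀ B : Matrix (Fin n) (Fin n) ℂ, parityQ n (od B) = -od B := fun B => by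
    simp [parityQ, od]
  have h1 : ∀ A A' : Matrix (Fin n) (Fin n) ℂ,
      parityQ n (superBracket (ev A) (ev A')) = superBracket (ev A) (ev A') := fun A A' => by
    simp [parityQ, superBracket, ev]
  have h2 : ∀ A B : Matrix (Fin n) (Fin n) ℂ,
      parityQ n (superBracket (ev A) (od B)) = -superBracket (ev A) (od B) := fun A B => by
    simp [parityQ, superBracket, ev, od]
  have h3 : ∀ B B' : Matrix (Fin n) (Fin n) ℂ,
      parityQ n (superBracket (od B) (od B')) = superBracket (od B) (od B') := fun B B' => by
    simp [parityQ, superBracket, od]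
  cases h with
  | ev_ev A A' =>
    simp only [map_sub, map_mul, TensorAlgebra.lift_ι_apply, LinearMap.comp_apply, hev, h1]
    exact incl_ev_ev A A'
  | ev_od A B =>
    simp only [map_sub, map_mul, map_neg, TensorAlgebra.lift_ι_apply, LinearMap.comp_apply, hev,
      hod, h2, ← incl_ev_od, mul_neg, neg_mul]
    abel
  | od_od B B' =>
    simp only [map_add, map_mul, map_neg, TensorAlgebra.lift_ι_apply, LinearMap.comp_apply, hod,
      h3, neg_mul_neg]
    exact incl_od_od B B'

/-- The parity involution `u ↦ (-1)^{|u|} u` of the superalgebra `U(q(n))`. -/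
noncomputable def parity (n : ℕ) : U n →ₐ[ℂ] U n :=
  RingQuot.liftAlgHom ℂ ⟨TensorAlgebra.lift ℂ (incl n ∘ₗ parityQ n), fun _ _ h => lift_rel h⟩

/-- The homogeneous components of `U(q(n))`: `U_ε = {u | parity u = (-1)^ε u}`, where
`false` stands for the even and `true` for the odd component. -/
noncomputable def grU (n : ℕ) (ε : Bool) : Submodule ℂ (U n) :=
  LinearMap.eqLocus (parity n).toLinearMap ((if ε then (-1 : ℂ) else 1) • LinearMap.id)

/-- The center of `U(q(n))`, consisting of the even central elements. -/
noncomputable def Z (n : ℕ) : Subalgebra ℂ (U n) :=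
  Subalgebra.center ℂ (U n) ⊓ AlgHom.equalizer (parity n) (AlgHom.id ℂ (U n))

/-- Weights, i.e. elements `lam = ∑ lam i • δ_i` of the dual of the even Cartan subalgebra of
diagonal matrices, given by coordinates with respect to the basis `δ_1, …, δ_n`. -/
abbrev Weight (n : ℕ) : Type := Fin n → ℂ

/-- The value of a weight on the even Cartan element `diag(h)`. -/
def Weight.val {n : ℕ} (lam : Weight n) (h : Fin n → ℂ) : ℂ := ∑ i, lam i * h i

/-- The form `⟨H, H'⟩_lam = lam([H, H'])` on the odd Cartan subalgebra, whose elements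
`od (diag a)` are given by `a : Fin n → ℂ`. -/
def oddForm {n : ℕ} (lam : Weight n) (a b : Fin n → ℂ) : ℂ :=
  lam.val (superBracket (od (Matrix.diagonal a)) (od (Matrix.diagonal b))).1.diag

/-- A subspace of the odd Cartan subalgebra that is isotropic for `⟨·, ·⟩_lam`. -/
def IsIsotropic {n : ℕ} (lam : Weight n) (W : Submodule ℂ (Fin n → ℂ)) : Prop :=
  ∀ a ∈ W, ∀ b ∈ W, oddForm lam a b = 0

/-- Given a subspace `W` (to be maximal isotropic for `⟨·, ·⟩_lam`) of the odd Cartan subalgebra,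
the left ideal of `U(q(n))` generated by the positive root vectors, by `h - lam(h)` for `h` in the
even Cartan subalgebra, and by `W`. -/
noncomputable def vermaIdeal {n : ℕ} (lam : Weight n) (W : Submodule ℂ (Fin n → ℂ)) :
    Submodule (U n) (U n) :=
  Submodule.span (U n)
    ({u | ∃ i j : Fin n, i < j ∧ u = incl n (ev (Matrix.single i j 1))} ∪
     {u | ∃ i j : Fin n, i < j ∧ u = incl n (od (Matrix.single i j 1))} ∪
     {u | ∃ h : Fin n → ℂ,
        u = incl n (ev (Matrix.diagonal h)) - algebraMap ℂ (U n) (lam.val h)} ∪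
     {u | ∃ w ∈ W, u = incl n (od (Matrix.diagonal w))})

/-- The Verma module `Δ(lam) = Ind_b^g Ind_{h'}^h ℂ v_lam`, where `h'` is the sum of the even
Cartan subalgebra and `W`. By transitivity of induction it is the module induced from the
one-dimensional module `ℂ v_lam` of `h' ⊕ n⁺`, i.e. the quotient of `U(q(n))` by `vermaIdeal`;
`v_lam` is the (even) class of `1`. -/
abbrev Verma {n : ℕ} (lam : Weight n) (W : Submodule ℂ (Fin n → ℂ)) : Type :=
  U n ⧸ vermaIdeal lam W

/-- The homogeneous components of the Verma module, with `v_lam` even. -/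
noncomputable def grVerma {n : ℕ} (lam : Weight n) (W : Submodule ℂ (Fin n → ℂ)) (ε : Bool) :
    Submodule ℂ (Verma lam W) :=
  (grU n ε).map ((vermaIdeal lam W).mkQ.restrictScalars ℂ)

/-- Graded submodules (subsupermodules): `N = (N ∩ M_even) + (N ∩ M_odd)`. -/
def IsGraded {n : ℕ} {M : Type} [AddCommGroup M] [Module ℂ M] [Module (U n) M]
    [IsScalarTower ℂ (U n) M] (gr : Bool → Submodule ℂ M) (N : Submodule (U n) M) : Prop :=
  N.restrictScalars ℂ =
    (N.restrictScalars ℂ ⊓ gr false) ⊔ (N.restrictScalars ℂ ⊓ gr true)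

/-- The unique maximal proper graded submodule of the Verma module: the sum of all proper graded
submodules. -/
noncomputable def maxSub {n : ℕ} (lam : Weight n) (W : Submodule ℂ (Fin n → ℂ)) :
    Submodule (U n) (Verma lam W) :=
  sSup {N | IsGraded (grVerma lam W) N ∧ N ≠ ⊤}

/-- The irreducible highest weight module `L(lam)`: the unique irreducible quotient of the
Verma module. -/
abbrev L {n : ℕ} (lam : Weight n) (W : Submodule ℂ (Fin n → ℂ)) : Type :=
  Verma lam W ⧸ maxSub lam W

/-- The homogeneous components of `L(lam)`. -/
noncomputable def grL {n : ℕ} (lam : Weight n) (W : Submodule ℂ (Fin n → ℂ)) (ε : Bool) :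
    Submodule ℂ (L lam W) :=
  (grVerma lam W ε).map ((maxSub lam W).mkQ.restrictScalars ℂ)

/-- The component of parity `ε` of the weight space of weight `mu` of a supermodule. -/
noncomputable def weightSpace (n : ℕ) {M : Type} [AddCommGroup M] [Module ℂ M] [Module (U n) M]
    [IsScalarTower ℂ (U n) M] (gr : Bool → Submodule ℂ M) (mu : Weight n) (ε : Bool) :
    Submodule ℂ M :=
  gr ε ⊓ ⨅ h : Fin n → ℂ, LinearMap.eqLocus
    ((Module.toModuleEnd ℂ (S := U n) M (incl n (ev (Matrix.diagonal h)))))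
    (mu.val h • LinearMap.id)

/-- The supercharacter of a supermodule with finite-dimensional weight spaces, as the family of
the coefficients of `e^mu`. -/
noncomputable def sch (n : ℕ) {M : Type} [AddCommGroup M] [Module ℂ M] [Module (U n) M]
    [IsScalarTower ℂ (U n) M] (gr : Bool → Submodule ℂ M) (mu : Weight n) : ℤ :=
  (Module.finrank ℂ (weightSpace n gr mu false) : ℤ) - Module.finrank ℂ (weightSpace n gr mu true)

/-- The module `M` has central character `χ`: the center acts on `M` through `χ`. -/
def HasCentralCharacter {n : ℕ} (M : Type) [AddCommGroup M] [Module ℂ M] [Module (U n) M]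
    (χ : Z n →ₐ[ℂ] ℂ) : Prop :=
  ∀ (z : Z n) (m : M), (z : U n) • m = χ z • m

/-- `χ_lam = χ_mu`: the irreducible modules `L(lam)` and `L(mu)` have the same central
character. -/
def SameCentralCharacter {n : ℕ} (W : Weight n → Submodule ℂ (Fin n → ℂ))
    (lam mu : Weight n) : Prop :=
  ∃ χ : Z n →ₐ[ℂ] ℂ,
    HasCentralCharacter (L lam (W lam)) χ ∧ HasCentralCharacter (L mu (W mu)) χ

/-- The non-negative integral linear combinations of the positive roots `δ_i - δ_j`, `i < j`. -/
def posCone (n : ℕ) : AddSubmonoid (Weight n) :=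
  AddSubmonoid.closure {α | ∃ i j : Fin n, i < j ∧ α = Pi.single i 1 - Pi.single j 1}

/-- The relation `lam ⪰ mu`. -/
def Succeq {n : ℕ} (W : Weight n → Submodule ℂ (Fin n → ℂ)) (lam mu : Weight n) : Prop :=
  SameCentralCharacter W lam mu ∧ lam - mu ∈ posCone n

end Queer

namespace Queer

variable {n : ℕ}

/-! ### The superbracket on homogeneous elements -/

/-! An odd Cartan element `H` with diagonal `a` squares to the even Cartan element with diagonal `a
* a`, so it acts on the weight space of weight `mu` with square `mu.val (a * a)`. If `mu ≠ 0`, some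
`H` is invertible there and exchanges the two parities, so the coefficient of `e^mu` vanishes
(`sch_eq_zero`).

At weight `0` the claim is that an even `z` commuting with the odd Cartan subalgebra has supertrace
`aug z` times the superdimension (`strOn_zero`). The coproduct of `z`, with its first factor
projected to the associative superalgebra `Q(n)`, gives matrices `P` and `Q` over `U`. Contracting
`P - z` and the twisted `Q` with the generators defines `euler z`, which equals `k z` modulo lower
degree when `z` has degree at most `k` (`eulerProp`). For invariant `z` it is a sum over `(i, j)` of
terms of supertrace zero: diagonal terms are zero or nilpotent on the zero weight space, and an
off-diagonal term can be moved cyclically to the nonzero weight `δ_j - δ_i`, where it commutes with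
an invertible odd Cartan element. Dividing by `k` and inducting on the degree leaves only the
constant term (`Inv.functional_eq`).

If the superdimension of the zero weight space of `L(lam)` is nonzero, comparing supertraces shows
that every central `z` acts by `aug z`, which is also its action on `L(0)`. Since `0` is then a
weight of `L(lam)`, `lam` lies in the positive cone, and in particular is integral.
Finite-dimensionality comes from spanning by products of negative root vectors, whose number is
bounded by the weight. -/

theorem superBracket_ev_ev (A A' : Matrix (Fin n) (Fin n) ℂ) :
    superBracket (ev A) (ev A') = ev (A * A' - A' * A) := by
  simp [superBracket, ev]

theorem superBracket_ev_od (A B : Matrix (Fin n) (Fin n) ℂ) :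
    superBracket (ev A) (od B) = od (A * B - B * A) := by
  simp [superBracket, ev, od]

theorem superBracket_od_od (B B' : Matrix (Fin n) (Fin n) ℂ) :
    superBracket (od B) (od B') = ev (B * B' + B' * B) := by
  simp [superBracket, ev, od]

/-- The even part of `q(n)` inside `U(q(n))`. -/
noncomputable def evU (n : ℕ) : Matrix (Fin n) (Fin n) ℂ →ₗ[ℂ] U n :=
  incl n ∘ₗ LinearMap.inl ℂ _ _

/-- The odd part of `q(n)` inside `U(q(n))`. -/
noncomputable def odU (n : ℕ) : Matrix (Fin n) (Fin n) ℂ →ₗ[ℂ] U n :=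
  incl n ∘ₗ LinearMap.inr ℂ _ _

theorem incl_ev (A : Matrix (Fin n) (Fin n) ℂ) : incl n (ev A) = evU n A := rfl

theorem incl_od (A : Matrix (Fin n) (Fin n) ℂ) : incl n (od A) = odU n A := rfl

theorem incl_eq (x : Q n) : incl n x = evU n x.1 + odU n x.2 := by
  rw [← incl_ev, ← incl_od, ← map_add]
  simp [ev, od]

theorem evU_mul_evU (A A' : Matrix (Fin n) (Fin n) ℂ) :
    evU n A * evU n A' = evU n A' * evU n A + evU n (A * A' - A' * A) := by
  have h := incl_ev_ev A A'
  rw [superBracket_ev_ev] at h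
  exact sub_eq_iff_eq_add'.mp h

theorem evU_mul_odU (A B : Matrix (Fin n) (Fin n) ℂ) :
    evU n A * odU n B = odU n B * evU n A + odU n (A * B - B * A) := by
  have h := incl_ev_od A B
  rw [superBracket_ev_od] at h
  exact sub_eq_iff_eq_add'.mp h

theorem odU_mul_odU (B B' : Matrix (Fin n) (Fin n) ℂ) :
    odU n B * odU n B' = -(odU n B' * odU n B) + evU n (B * B' + B' * B) := by
  have h := incl_od_od B B'
  rw [superBracket_od_od] at h
  rw [← show odU n B * odU n B' + odU n B' * odU n B = evU n (B * B' + B' * B) from h]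
  abel

theorem odU_mul_evU (B A : Matrix (Fin n) (Fin n) ℂ) :
    odU n B * evU n A = evU n A * odU n B + odU n (B * A - A * B) := by
  rw [evU_mul_odU, add_assoc, ← map_add]
  simp

/-- The anticommutator of `B` with itself is counted twice on both sides, so 2 cancels. -/
theorem odU_mul_self (B : Matrix (Fin n) (Fin n) ℂ) : odU n B * odU n B = evU n (B * B) := by
  have h := odU_mul_odU B B
  have h2 : (2 : ℂ) • (odU n B * odU n B) = (2 : ℂ) • evU n (B * B) := by
    rw [two_smul, two_smul, ← map_add]
    exact eq_neg_add_iff_add_eq.mp h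
  exact smul_right_injective _ (two_ne_zero) h2

/-! ### Universal property and induction -/

theorem mkU_surjective : Function.Surjective (mkU n) := RingQuot.mkAlgHom_surjective ℂ (Rel n)

/-- An induction principle for `U(q(n))`. -/
theorem U.induction {C : U n → Prop} (scalar : ∀ c, C (algebraMap ℂ (U n) c))
    (even : ∀ A, C (evU n A)) (odd : ∀ A, C (odU n A))
    (mul : ∀ a b, C a → C b → C (a * b)) (add : ∀ a b, C a → C b → C (a + b)) (u : U n) :
    C u := by
  obtain ⟨t, rfl⟩ := mkU_surjective u
  induction t using TensorAlgebra.induction with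
  | algebraMap r => simpa using scalar r
  | ι x =>
    change C (incl n x)
    rw [incl_eq]
    exact add _ _ (even _) (odd _)
  | mul a b ha hb => simpa using mul _ _ ha hb
  | add a b ha hb => simpa using add _ _ ha hb

/-- The universal property of `U(q(n))`. -/
noncomputable def liftU {R : Type*} [Ring R] [Algebra ℂ R]
    (f g : Matrix (Fin n) (Fin n) ℂ →ₗ[ℂ] R)
    (hff : ∀ A A', f A * f A' - f A' * f A = f (A * A' - A' * A))
    (hfg : ∀ A B, f A * g B - g B * f A = g (A * B - B * A))
    (hgg : ∀ B B', g B * g B' + g B' * g B = f (B * B' + B' * B)) : U n →ₐ[ℂ] R :=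
  RingQuot.liftAlgHom ℂ ⟨TensorAlgebra.lift ℂ (f.coprod g), fun _ _ h => by
    cases h with
    | ev_ev A A' =>
      rw [superBracket_ev_ev]
      simpa [ev] using hff A A'
    | ev_od A B =>
      rw [superBracket_ev_od]
      simpa [ev, od] using hfg A B
    | od_od B B' =>
      rw [superBracket_od_od]
      simpa [ev, od] using hgg B B'⟩

theorem liftAlgHom_incl {R : Type*} [Ring R] [Algebra ℂ R] (f : Q n →ₗ[ℂ] R)
    (h : ∀ ⦃x y⦄, Rel n x y → TensorAlgebra.lift ℂ f x = TensorAlgebra.lift ℂ f y) (x : Q n) :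
    (RingQuot.liftAlgHom ℂ ⟨TensorAlgebra.lift ℂ f, h⟩ : U n →ₐ[ℂ] R) (incl n x) = f x := by
  have h1 := RingQuot.liftAlgHom_mkAlgHom_apply ℂ (TensorAlgebra.lift ℂ f) h (TensorAlgebra.ι ℂ x)
  rw [TensorAlgebra.lift_ι_apply] at h1
  exact h1

section
variable {R : Type*} [Ring R] [Algebra ℂ R] (f g : Matrix (Fin n) (Fin n) ℂ →ₗ[ℂ] R)
    (hff : ∀ A A', f A * f A' - f A' * f A = f (A * A' - A' * A))
    (hfg : ∀ A B, f A * g B - g B * f A = g (A * B - B * A))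
    (hgg : ∀ B B', g B * g B' + g B' * g B = f (B * B' + B' * B))

theorem liftU_evU (A : Matrix (Fin n) (Fin n) ℂ) : liftU f g hff hfg hgg (evU n A) = f A := by
  rw [← incl_ev]
  exact (liftAlgHom_incl _ _ _).trans (by simp [ev])

theorem liftU_odU (A : Matrix (Fin n) (Fin n) ℂ) : liftU f g hff hfg hgg (odU n A) = g A := by
  rw [← incl_od]
  exact (liftAlgHom_incl _ _ _).trans (by simp [od])
end

theorem parity_evU (A : Matrix (Fin n) (Fin n) ℂ) : parity n (evU n A) = evU n A := by
  rw [← incl_ev]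
  exact (liftAlgHom_incl _ _ _).trans (by simp [parityQ, ev])

theorem parity_odU (A : Matrix (Fin n) (Fin n) ℂ) : parity n (odU n A) = -odU n A := by
  rw [← incl_od, ← map_neg]
  exact (liftAlgHom_incl _ _ _).trans (by simp [parityQ, od])

theorem parity_parity (u : U n) : parity n (parity n u) = u := by
  induction u using U.induction with
  | scalar c => simp
  | even A => simp [parity_evU]
  | odd A => simp [parity_odU]
  | mul a b ha hb => simp [ha, hb]
  | add a b ha hb => simp [ha, hb]

/-- The augmentation `U(q(n)) → ℂ`. -/
noncomputable def aug (n : ℕ) : U n →ₐ[ℂ] ℂ :=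
  liftU 0 0 (by simp) (by simp) (by simp)

@[simp] theorem aug_evU (A : Matrix (Fin n) (Fin n) ℂ) : aug n (evU n A) = 0 := by
  rw [aug, liftU_evU]; rfl

@[simp] theorem aug_odU (A : Matrix (Fin n) (Fin n) ℂ) : aug n (odU n A) = 0 := by
  rw [aug, liftU_odU]; rfl

@[simp] theorem aug_parity (u : U n) : aug n (parity n u) = aug n u := by
  induction u using U.induction with
  | scalar c => simp
  | even A => simp [parity_evU]
  | odd A => simp [parity_odU]
  | mul a b ha hb => simp [ha, hb]
  | add a b ha hb => simp [ha, hb]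

/-! ### The coproduct with values in `Q(n) ⊗ U(q(n))` -/

/-- Scalar matrices over `U(q(n))` as a linear map. -/
noncomputable def scal (n : ℕ) : U n →ₗ[ℂ] Matrix (Fin n) (Fin n) (U n) :=
  Matrix.diagonalLinearMap (Fin n) ℂ (U n) ∘ₗ LinearMap.pi fun _ => LinearMap.id

theorem scal_apply (u : U n) : scal n u = Matrix.diagonal fun _ => u := rfl

/-- Complex matrices as matrices over `U(q(n))`. -/
noncomputable def coef (n : ℕ) : Matrix (Fin n) (Fin n) ℂ →ₐ[ℂ] Matrix (Fin n) (Fin n) (U n) :=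
  (Algebra.ofId ℂ (U n)).mapMatrix

theorem coef_apply (A : Matrix (Fin n) (Fin n) ℂ) (i j : Fin n) :
    coef n A i j = algebraMap ℂ (U n) (A i j) := rfl

theorem scal_mul (u v : U n) : scal n (u * v) = scal n u * scal n v := by
  simp [scal_apply]

theorem scal_mul_coef (u : U n) (A : Matrix (Fin n) (Fin n) ℂ) :
    scal n u * coef n A = coef n A * scal n u := by
  ext i j
  simp [scal_apply, coef_apply, Matrix.diagonal_mul, Matrix.mul_diagonal, Algebra.commutes]

/-- Block matrices over `U(q(n))`. -/
abbrev BlockU (n : ℕ) : Type := Matrix (Fin n ⊕ Fin n) (Fin n ⊕ Fin n) (U n)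

/-- The coproduct on even elements. -/
noncomputable def coprodEv (n : ℕ) : Matrix (Fin n) (Fin n) ℂ →ₗ[ℂ] BlockU n where
  toFun A := Matrix.fromBlocks (coef n A + scal n (evU n A)) 0 0 (coef n A + scal n (evU n A))
  map_add' A B := by
    rw [Matrix.fromBlocks_add]; simp only [map_add, add_zero]; congr 1 <;> abel
  map_smul' c A := by simp [Matrix.fromBlocks_smul]

/-- The coproduct on odd elements. -/
noncomputable def coprodOd (n : ℕ) : Matrix (Fin n) (Fin n) ℂ →ₗ[ℂ] BlockU n where
  toFun A := Matrix.fromBlocks (scal n (odU n A)) (coef n A) (coef n A) (-scal n (odU n A))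
  map_add' A B := by
    rw [Matrix.fromBlocks_add]; simp only [map_add]; congr 1; abel
  map_smul' c A := by simp [Matrix.fromBlocks_smul]

/-- The coproduct `U(q(n)) → Q(n) ⊗ U(q(n))`, `x ↦ x ⊗ 1 + 1 ⊗ x`, where an element of the
superalgebra `Q(n) ⊗ U(q(n))` is written as a block matrix `[P, Q; σ Q, σ P]` with `σ` the parity
involution. -/
noncomputable def coprod (n : ℕ) : U n →ₐ[ℂ] BlockU n :=
  liftU (coprodEv n) (coprodOd n)
    (fun A A' => by
      have h := congrArg (scal n) (evU_mul_evU A A')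
      rw [map_add, scal_mul, scal_mul] at h
      rw [sub_eq_iff_eq_add]
      simp only [coprodEv, LinearMap.coe_mk, AddHom.coe_mk, Matrix.fromBlocks_multiply,
        Matrix.fromBlocks_add, mul_zero, zero_mul, add_zero, zero_add, mul_add, add_mul, h,
        scal_mul_coef, map_sub (coef n), map_mul (coef n)]
      congr 1 <;> abel)
    (fun A B => by
      have h := congrArg (scal n) (evU_mul_odU A B)
      rw [map_add, scal_mul, scal_mul] at h
      rw [sub_eq_iff_eq_add]
      simp only [coprodEv, coprodOd, LinearMap.coe_mk, AddHom.coe_mk, Matrix.fromBlocks_multiply,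
        Matrix.fromBlocks_add, mul_zero, zero_mul, add_zero, zero_add, mul_add, add_mul, h,
        scal_mul_coef, map_sub (coef n), map_mul (coef n), mul_neg, neg_mul]
      congr 1 <;> abel)
    (fun B B' => by
      have h := congrArg (scal n) (odU_mul_odU B B')
      rw [map_add, map_neg, scal_mul, scal_mul] at h
      simp only [coprodEv, coprodOd, LinearMap.coe_mk, AddHom.coe_mk, Matrix.fromBlocks_multiply,
        Matrix.fromBlocks_add, h, scal_mul_coef, map_add, map_mul, mul_neg, neg_mul]
      congr 1 <;> abel)

/-- The component `P` of the coproduct. -/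
noncomputable def cP (u : U n) : Matrix (Fin n) (Fin n) (U n) := (coprod n u).toBlocks₁₁

/-- The component `Q` of the coproduct. -/
noncomputable def cQ (u : U n) : Matrix (Fin n) (Fin n) (U n) := (coprod n u).toBlocks₁₂

/-- The entrywise parity involution. -/
noncomputable def par (n : ℕ) : Matrix (Fin n) (Fin n) (U n) →ₐ[ℂ] Matrix (Fin n) (Fin n) (U n) :=
  (parity n).mapMatrix

theorem par_apply (X : Matrix (Fin n) (Fin n) (U n)) (i j : Fin n) :
    par n X i j = parity n (X i j) := rfl

theorem par_par (X : Matrix (Fin n) (Fin n) (U n)) : par n (par n X) = X := by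
  ext i j
  simp [par_apply, parity_parity]

theorem par_scal (u : U n) : par n (scal n u) = scal n (parity n u) := by
  ext i j
  by_cases h : i = j <;> simp [par_apply, scal_apply, h]

theorem par_coef (A : Matrix (Fin n) (Fin n) ℂ) : par n (coef n A) = coef n A := by
  ext i j
  simp [par_apply, coef_apply]

theorem coprod_evU (A : Matrix (Fin n) (Fin n) ℂ) : coprod n (evU n A) =
    Matrix.fromBlocks (coef n A + scal n (evU n A)) 0 0 (coef n A + scal n (evU n A)) := by
  rw [coprod, liftU_evU]; rfl

theorem coprod_odU (A : Matrix (Fin n) (Fin n) ℂ) : coprod n (odU n A) =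
    Matrix.fromBlocks (scal n (odU n A)) (coef n A) (coef n A) (-scal n (odU n A)) := by
  rw [coprod, liftU_odU]; rfl

theorem coprod_algebraMap (c : ℂ) : coprod n (algebraMap ℂ (U n) c) =
    Matrix.fromBlocks (scal n (algebraMap ℂ (U n) c)) 0 0 (scal n (algebraMap ℂ (U n) c)) := by
  rw [AlgHom.commutes]
  ext i j
  rcases i with i | i <;> rcases j with j | j <;>
    simp [Matrix.algebraMap_matrix_apply, scal_apply, Matrix.diagonal_apply]

/-- The twisted second row encodes the sign rule: an element of `U` passing the odd generator of
`Q(n)` is hit by the parity involution. Matrices of this shape are closed under sums and products,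
so it is enough to check generators. -/
theorem coprod_eq (u : U n) :
    coprod n u = Matrix.fromBlocks (cP u) (cQ u) (par n (cQ u)) (par n (cP u)) := by
  induction u using U.induction with
  | scalar c =>
    simp only [cP, cQ]
    rw [coprod_algebraMap]
    simp [par_scal]
  | even A => simp [cP, cQ, coprod_evU, par_scal, par_coef, parity_evU]
  | odd A => simp [cP, cQ, coprod_odU, par_scal, par_coef, parity_odU]
  | mul a b ha hb =>
    have h := map_mul (coprod n) a b
    rw [ha, hb, Matrix.fromBlocks_multiply] at h
    have hP : cP (a * b) = cP a * cP b + cQ a * par n (cQ b) := by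
      rw [cP, h, Matrix.toBlocks_fromBlocks₁₁]
    have hQ : cQ (a * b) = cP a * cQ b + cQ a * par n (cP b) := by
      rw [cQ, h, Matrix.toBlocks_fromBlocks₁₂]
    rw [h, hP, hQ]
    simp only [map_add, map_mul, par_par]
    rw [add_comm (par n (cQ a) * _), add_comm (par n (cQ a) * _)]
  | add a b ha hb =>
    have h := map_add (coprod n) a b
    rw [ha, hb, Matrix.fromBlocks_add] at h
    have hP : cP (a + b) = cP a + cP b := by
      rw [cP, h, Matrix.toBlocks_fromBlocks₁₁]
    have hQ : cQ (a + b) = cQ a + cQ b := by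
      rw [cQ, h, Matrix.toBlocks_fromBlocks₁₂]
    rw [h, hP, hQ, map_add, map_add]

theorem cP_mul (a b : U n) : cP (a * b) = cP a * cP b + cQ a * par n (cQ b) := by
  rw [cP, map_mul, coprod_eq a, coprod_eq b, Matrix.fromBlocks_multiply,
    Matrix.toBlocks_fromBlocks₁₁]

theorem cQ_mul (a b : U n) : cQ (a * b) = cP a * cQ b + cQ a * par n (cP b) := by
  rw [cQ, map_mul, coprod_eq a, coprod_eq b, Matrix.fromBlocks_multiply,
    Matrix.toBlocks_fromBlocks₁₂]

theorem cP_add (a b : U n) : cP (a + b) = cP a + cP b := by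
  rw [cP, map_add]; rfl

theorem cQ_add (a b : U n) : cQ (a + b) = cQ a + cQ b := by
  rw [cQ, map_add]; rfl

theorem cP_algebraMap (c : ℂ) :
    cP (algebraMap ℂ (U n) c) = scal n (algebraMap ℂ (U n) c) := by
  rw [cP, coprod_algebraMap, Matrix.toBlocks_fromBlocks₁₁]

theorem cQ_algebraMap (c : ℂ) : cQ (algebraMap ℂ (U n) c) = 0 := by
  rw [cQ, coprod_algebraMap, Matrix.toBlocks_fromBlocks₁₂]

theorem cP_evU (A : Matrix (Fin n) (Fin n) ℂ) : cP (evU n A) = coef n A + scal n (evU n A) := by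
  rw [cP, coprod_evU, Matrix.toBlocks_fromBlocks₁₁]

theorem cQ_evU (A : Matrix (Fin n) (Fin n) ℂ) : cQ (evU n A) = 0 := by
  rw [cQ, coprod_evU, Matrix.toBlocks_fromBlocks₁₂]

theorem cP_odU (A : Matrix (Fin n) (Fin n) ℂ) : cP (odU n A) = scal n (odU n A) := by
  rw [cP, coprod_odU, Matrix.toBlocks_fromBlocks₁₁]

theorem cQ_odU (A : Matrix (Fin n) (Fin n) ℂ) : cQ (odU n A) = coef n A := by
  rw [cQ, coprod_odU, Matrix.toBlocks_fromBlocks₁₂]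

/-- The coproduct respects total parity, and the `Q` component carries an odd factor from `Q(n)`,
whence the extra sign. -/
theorem parity_components (u : U n) :
    cP (parity n u) = par n (cP u) ∧ cQ (parity n u) = -par n (cQ u) := by
  induction u using U.induction with
  | scalar c => simp [cP_algebraMap, cQ_algebraMap, par_scal]
  | even A => simp [cP_evU, cQ_evU, parity_evU, par_scal, par_coef]
  | odd A =>
    have h : ∀ u : U n, cP (-u) = -cP u ∧ cQ (-u) = -cQ u := fun u => by
      constructor
      · rw [cP, map_neg]; rfl
      · rw [cQ, map_neg]; rfl
    simp [cP_odU, cQ_odU, parity_odU, par_scal, par_coef, h]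
  | mul a b ha hb =>
    simp only [map_mul, cP_mul, cQ_mul, ha.1, ha.2, hb.1, hb.2, map_add, map_neg, neg_mul, mul_neg,
      neg_neg, neg_add, and_self]
  | add a b ha hb =>
    simp only [map_add, cP_add, cQ_add, ha.1, ha.2, hb.1, hb.2, neg_add, and_self]

/-! ### The filtration of `U(q(n))` and the contraction -/

/-- The span of `1` and `q(n)` in `U(q(n))`. -/
noncomputable def gen (n : ℕ) : Submodule ℂ (U n) :=
  1 ⊔ (LinearMap.range (evU n) ⊔ LinearMap.range (odU n))

theorem algebraMap_mem_gen (c : ℂ) : algebraMap ℂ (U n) c ∈ gen n :=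
  Submodule.mem_sup_left (Submodule.algebraMap_mem c)

theorem evU_mem_gen (A : Matrix (Fin n) (Fin n) ℂ) : evU n A ∈ gen n :=
  Submodule.mem_sup_right (Submodule.mem_sup_left ⟨A, rfl⟩)

theorem odU_mem_gen (A : Matrix (Fin n) (Fin n) ℂ) : odU n A ∈ gen n :=
  Submodule.mem_sup_right (Submodule.mem_sup_right ⟨A, rfl⟩)

theorem exists_of_mem_gen {u : U n} (hu : u ∈ gen n) :
    ∃ c A B, u = algebraMap ℂ (U n) c + (evU n A + odU n B) := by
  obtain ⟨x, hx, y, hy, rfl⟩ := Submodule.mem_sup.mp hu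
  obtain ⟨y, ⟨A, rfl⟩, z, ⟨B, rfl⟩, rfl⟩ := Submodule.mem_sup.mp hy
  obtain ⟨c, rfl⟩ := Submodule.mem_one.mp hx
  exact ⟨c, A, B, rfl⟩

/-- The filtration by powers of `gen n`, shifted by one. -/
noncomputable def fil (n : ℕ) : ℕ → Submodule ℂ (U n)
  | 0 => ⊥
  | k + 1 => gen n ^ k

theorem mul_mem_fil {k : ℕ} {g w : U n} (hg : g ∈ gen n) (hw : w ∈ fil n k) :
    g * w ∈ fil n (k + 1) := by
  cases k with
  | zero =>
    rw [(Submodule.mem_bot ℂ).mp hw, mul_zero]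
    exact zero_mem _
  | succ k =>
    change g * w ∈ gen n ^ (k + 1)
    rw [pow_succ']
    exact Submodule.mul_mem_mul hg hw

/-- The filtration increases because `1 ∈ gen n`. -/
theorem fil_le {k : ℕ} {w : U n} (hw : w ∈ fil n k) : w ∈ fil n (k + 1) := by
  have := mul_mem_fil (algebraMap_mem_gen 1) hw
  rwa [map_one, one_mul] at this

theorem exists_mem_fil (u : U n) : ∃ k, u ∈ fil n k := by
  have mono : ∀ {k l : ℕ} {w : U n}, k ≤ l → w ∈ fil n k → w ∈ fil n l := fun h hw => by
    induction h with
    | refl => exact hw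
    | step _ ih => exact fil_le ih
  have h1 : ∀ w ∈ gen n, w ∈ fil n 2 := fun w hw => by
    change w ∈ gen n ^ 1
    rwa [pow_one]
  induction u using U.induction with
  | scalar c => exact ⟨2, h1 _ (algebraMap_mem_gen c)⟩
  | even A => exact ⟨2, h1 _ (evU_mem_gen A)⟩
  | odd A => exact ⟨2, h1 _ (odU_mem_gen A)⟩
  | mul a b ha hb =>
    obtain ⟨k, hk⟩ := ha
    obtain ⟨l, hl⟩ := hb
    refine ⟨k + l + 1, ?_⟩
    change a * b ∈ gen n ^ (k + l)
    rw [pow_add]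
    exact Submodule.mul_mem_mul (fil_le hk) (fil_le hl)
  | add a b ha hb =>
    obtain ⟨k, hk⟩ := ha
    obtain ⟨l, hl⟩ := hb
    exact ⟨k + l, add_mem (mono (Nat.le_add_right k l) hk) (mono (Nat.le_add_left l k) hl)⟩

/-- The multiplication map `q(n) ⊗ U(q(n)) → U(q(n))`. -/
noncomputable def contract (X Y : Matrix (Fin n) (Fin n) (U n)) : U n :=
  ∑ i, ∑ j, (evU n (Matrix.single i j 1) * X i j + odU n (Matrix.single i j 1) * Y i j)

theorem contract_add (X X' Y Y' : Matrix (Fin n) (Fin n) (U n)) :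
    contract (X + X') (Y + Y') = contract X Y + contract X' Y' := by
  simp only [contract, ← Finset.sum_add_distrib]
  refine Finset.sum_congr rfl fun i _ => Finset.sum_congr rfl fun j _ => ?_
  simp only [Matrix.add_apply, mul_add]
  abel

/-- Contraction inverts the expansion of `A` in matrix units. This term supplies the extra copy of
the product that raises the Euler eigenvalue by one. -/
theorem contract_coef_left (A : Matrix (Fin n) (Fin n) ℂ) (u : U n) :
    contract (coef n A * scal n u) 0 = evU n A * u := by
  conv_rhs => rw [Matrix.matrix_eq_sum_single A]
  simp only [contract, map_sum, Finset.sum_mul]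
  refine Finset.sum_congr rfl fun i _ => Finset.sum_congr rfl fun j _ => ?_
  rw [scal_apply, Matrix.mul_diagonal, coef_apply, Matrix.zero_apply, mul_zero, add_zero,
    ← Algebra.smul_def, mul_smul_comm, ← smul_mul_assoc, ← map_smul, Matrix.smul_single,
    smul_eq_mul, mul_one]

theorem contract_coef_right (A : Matrix (Fin n) (Fin n) ℂ) (u : U n) :
    contract 0 (coef n A * scal n u) = odU n A * u := by
  conv_rhs => rw [Matrix.matrix_eq_sum_single A]
  simp only [contract, map_sum, Finset.sum_mul]
  refine Finset.sum_congr rfl fun i _ => Finset.sum_congr rfl fun j _ => ?_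
  rw [scal_apply, Matrix.mul_diagonal, coef_apply, Matrix.zero_apply, mul_zero, zero_add,
    ← Algebra.smul_def, mul_smul_comm, ← smul_mul_assoc, ← map_smul, Matrix.smul_single,
    smul_eq_mul, mul_one]

theorem contract_mem {k : ℕ} {X Y : Matrix (Fin n) (Fin n) (U n)} (hX : ∀ i j, X i j ∈ fil n k)
    (hY : ∀ i j, Y i j ∈ fil n k) : contract X Y ∈ fil n (k + 1) :=
  sum_mem fun i _ => sum_mem fun j _ =>
    add_mem (mul_mem_fil (evU_mem_gen _) (hX i j)) (mul_mem_fil (odU_mem_gen _) (hY i j))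

theorem scal_mul_apply (u : U n) (X : Matrix (Fin n) (Fin n) (U n)) (i j : Fin n) :
    (scal n u * X) i j = u * X i j := by
  rw [scal_apply, Matrix.diagonal_mul]

theorem coef_mul_mem {S : Submodule ℂ (U n)} (A : Matrix (Fin n) (Fin n) ℂ)
    {X : Matrix (Fin n) (Fin n) (U n)} (hX : ∀ i j, X i j ∈ S) (i j : Fin n) :
    (coef n A * X) i j ∈ S := by
  rw [Matrix.mul_apply]
  refine sum_mem fun l _ => ?_
  rw [coef_apply, ← Algebra.smul_def]
  exact S.smul_mem _ (hX l j)

/-- Pulling `A` to the left through the matrix units leaves only commutators, which lie in `gen n`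
and multiply entries from `fil n k`. -/
theorem contract_evU_mem {k : ℕ} (A : Matrix (Fin n) (Fin n) ℂ)
    {X Y : Matrix (Fin n) (Fin n) (U n)} (hX : ∀ i j, X i j ∈ fil n k)
    (hY : ∀ i j, Y i j ∈ fil n k) :
    contract (scal n (evU n A) * X) (scal n (evU n A) * Y) - evU n A * contract X Y ∈
      fil n (k + 1) := by
  simp only [contract, Finset.mul_sum, ← Finset.sum_sub_distrib]
  refine sum_mem fun i _ => sum_mem fun j _ => ?_
  rw [scal_mul_apply, scal_mul_apply, ← mul_assoc, ← mul_assoc, mul_add, ← mul_assoc, ← mul_assoc,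
    evU_mul_evU (Matrix.single i j 1), odU_mul_evU (Matrix.single i j 1), add_mul, add_mul]
  convert add_mem (mul_mem_fil (evU_mem_gen (Matrix.single i j 1 * A - A * Matrix.single i j 1))
    (hX i j)) (mul_mem_fil (odU_mem_gen (Matrix.single i j 1 * A - A * Matrix.single i j 1))
    (hY i j)) using 1
  abel

/-- The minus sign on the second argument offsets the sign of interchanging two odd generators; only
bracket terms survive. -/
theorem contract_odU_mem {k : ℕ} (B : Matrix (Fin n) (Fin n) ℂ)
    {X Y : Matrix (Fin n) (Fin n) (U n)} (hX : ∀ i j, X i j ∈ fil n k)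
    (hY : ∀ i j, Y i j ∈ fil n k) :
    contract (scal n (odU n B) * X) (-(scal n (odU n B) * Y)) - odU n B * contract X Y ∈
      fil n (k + 1) := by
  simp only [contract, Finset.mul_sum, ← Finset.sum_sub_distrib]
  refine sum_mem fun i _ => sum_mem fun j _ => ?_
  rw [Matrix.neg_apply, scal_mul_apply, scal_mul_apply, mul_neg, ← mul_assoc, ← mul_assoc, mul_add,
    ← mul_assoc, ← mul_assoc, evU_mul_odU (Matrix.single i j 1), odU_mul_odU (Matrix.single i j 1),
    add_mul, add_mul]
  convert sub_mem (mul_mem_fil (odU_mem_gen (Matrix.single i j 1 * B - B * Matrix.single i j 1))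
    (hX i j)) (mul_mem_fil (evU_mem_gen (Matrix.single i j 1 * B + B * Matrix.single i j 1))
    (hY i j)) using 1
  rw [neg_mul]
  abel

/-! ### The reduced coproduct and the Euler operator -/

/-- The reduced even component of the coproduct. -/
noncomputable def rP (u : U n) : Matrix (Fin n) (Fin n) (U n) := cP u - scal n u

theorem cP_eq (u : U n) : cP u = rP u + scal n u := (sub_add_cancel _ _).symm

theorem rP_add (u v : U n) : rP (u + v) = rP u + rP v := by
  simp only [rP, cP_add, map_add]; abel

/-- The contraction of the reduced coproduct; on `U(q(n))` it multiplies the component of degree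
`k` of the associated graded algebra by `k`. -/
noncomputable def euler (u : U n) : U n := contract (rP u) (par n (cQ u))

theorem euler_add (u v : U n) : euler (u + v) = euler u + euler v := by
  rw [euler, rP_add, cQ_add, map_add, contract_add]; rfl

/-- The properties of the reduced coproduct of an element of degree at most `k`. -/
structure EulerProp (k : ℕ) (u : U n) : Prop where
  memP : ∀ i j, rP u i j ∈ fil n k
  memQ : ∀ i j, par n (cQ u) i j ∈ fil n k
  mem : euler u - (k : ℂ) • u ∈ fil n k

theorem EulerProp.add {k : ℕ} {u v : U n} (hu : EulerProp k u) (hv : EulerProp k v) :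
    EulerProp k (u + v) where
  memP i j := by rw [rP_add]; exact add_mem (hu.memP i j) (hv.memP i j)
  memQ i j := by rw [cQ_add, map_add]; exact add_mem (hu.memQ i j) (hv.memQ i j)
  mem := by
    rw [euler_add, smul_add, add_sub_add_comm]
    exact add_mem hu.mem hv.mem

theorem rP_algebraMap_mul (c : ℂ) (u : U n) : rP (algebraMap ℂ (U n) c * u) = c • rP u := by
  rw [rP, cP_mul, cP_algebraMap, cQ_algebraMap, scal_mul, zero_mul, add_zero, ← mul_sub]
  ext i j
  rw [scal_mul_apply, Matrix.smul_apply, Algebra.smul_def]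
  rfl

theorem cQ_algebraMap_mul (c : ℂ) (u : U n) : cQ (algebraMap ℂ (U n) c * u) = c • cQ u := by
  rw [cQ_mul, cP_algebraMap, cQ_algebraMap, zero_mul, add_zero]
  ext i j
  rw [scal_mul_apply, Matrix.smul_apply, Algebra.smul_def]

theorem euler_algebraMap_mul (c : ℂ) (u : U n) :
    euler (algebraMap ℂ (U n) c * u) = c • euler u := by
  rw [euler, rP_algebraMap_mul, cQ_algebraMap_mul, map_smul, euler, contract, contract]
  simp only [Finset.smul_sum, Matrix.smul_apply, mul_smul_comm, smul_add]

theorem EulerProp.algebraMap_mul {k : ℕ} {u : U n} (hu : EulerProp k u) (h : u ∈ fil n (k + 1))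
    (c : ℂ) : EulerProp (k + 1) (algebraMap ℂ (U n) c * u) where
  memP i j := by
    rw [rP_algebraMap_mul]; exact Submodule.smul_mem _ c (fil_le (hu.memP i j))
  memQ i j := by
    rw [cQ_algebraMap_mul, map_smul]; exact Submodule.smul_mem _ c (fil_le (hu.memQ i j))
  mem := by
    rw [euler_algebraMap_mul, ← Algebra.smul_def, smul_comm, ← smul_sub]
    refine Submodule.smul_mem _ c ?_
    -- Counting the degree as `k + 1` instead of `k` changes the expression by `u` itself, which
    -- already lies in `fil n (k + 1)`.
    have := sub_mem (fil_le hu.mem) h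
    convert this using 1
    rw [Nat.cast_succ, add_smul, one_smul, sub_sub]

/-- The reduced coproduct of `A u` has three kinds of terms: `A` times that of `u` contributes `A`
times `euler u` up to lower order, the coefficients of `A` times that of `u` are of lower order, and
`A ⊗ u` contracts to one further copy of `A u`. -/
theorem EulerProp.evU_mul {k : ℕ} {u : U n} (hu : EulerProp k u) (h : u ∈ fil n (k + 1))
    (A : Matrix (Fin n) (Fin n) ℂ) : EulerProp (k + 1) (evU n A * u) := by
  have hP : rP (evU n A * u) =
      scal n (evU n A) * rP u + (coef n A * rP u + coef n A * scal n u) := by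
    rw [rP, cP_mul, cP_evU, cQ_evU, scal_mul, zero_mul, add_zero, cP_eq u]
    simp only [mul_add, add_mul]
    abel
  have hQ : par n (cQ (evU n A * u)) =
      scal n (evU n A) * par n (cQ u) + (coef n A * par n (cQ u) + 0) := by
    rw [cQ_mul, cP_evU, cQ_evU, zero_mul, add_zero, add_mul, map_add, map_mul, map_mul, par_coef,
      par_scal, parity_evU, add_comm, add_zero]
  refine ⟨fun i j => ?_, fun i j => ?_, ?_⟩
  · rw [hP, Matrix.add_apply, Matrix.add_apply]
    refine add_mem ?_ (add_mem (fil_le (coef_mul_mem A hu.memP i j)) ?_)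
    · rw [scal_mul_apply]; exact mul_mem_fil (evU_mem_gen A) (hu.memP i j)
    · rw [scal_apply, Matrix.mul_diagonal, coef_apply, ← Algebra.smul_def]
      exact Submodule.smul_mem _ _ h
  · rw [hQ, add_zero, Matrix.add_apply]
    refine add_mem ?_ (fil_le (coef_mul_mem A hu.memQ i j))
    rw [scal_mul_apply]; exact mul_mem_fil (evU_mem_gen A) (hu.memQ i j)
  · rw [euler, hP, hQ, contract_add, contract_add, contract_coef_left]
    have h1 := contract_evU_mem A hu.memP hu.memQ
    have h2 := contract_mem (coef_mul_mem A hu.memP) (coef_mul_mem A hu.memQ)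
    have h3 := mul_mem_fil (evU_mem_gen A) hu.mem
    convert add_mem (add_mem h1 h2) h3 using 1
    rw [euler, mul_sub, mul_smul_comm, Nat.cast_succ, add_smul, one_smul]
    abel

/-- The argument is that of `EulerProp.evU_mul`, but an odd coefficient swaps the two components, so
`A ⊗ u` now appears in `Q`. -/
theorem EulerProp.odU_mul {k : ℕ} {u : U n} (hu : EulerProp k u) (h : u ∈ fil n (k + 1))
    (A : Matrix (Fin n) (Fin n) ℂ) : EulerProp (k + 1) (odU n A * u) := by
  have hP : rP (odU n A * u) =
      scal n (odU n A) * rP u + (coef n A * par n (cQ u) + 0) := by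
    rw [rP, cP_mul, cP_odU, cQ_odU, scal_mul, cP_eq u]
    simp only [mul_add]
    abel
  have hQ : par n (cQ (odU n A * u)) =
      -(scal n (odU n A) * par n (cQ u)) + (coef n A * rP u + coef n A * scal n u) := by
    rw [cQ_mul, cP_odU, cQ_odU, map_add, map_mul, map_mul, par_coef, par_par,
      par_scal, parity_odU, map_neg, neg_mul, cP_eq u, mul_add]
  refine ⟨fun i j => ?_, fun i j => ?_, ?_⟩
  · rw [hP, add_zero, Matrix.add_apply]
    refine add_mem ?_ (fil_le (coef_mul_mem A hu.memQ i j))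
    rw [scal_mul_apply]; exact mul_mem_fil (odU_mem_gen A) (hu.memP i j)
  · rw [hQ, Matrix.add_apply, Matrix.add_apply]
    refine add_mem ?_ (add_mem (fil_le (coef_mul_mem A hu.memP i j)) ?_)
    · rw [Matrix.neg_apply, scal_mul_apply]
      exact neg_mem (mul_mem_fil (odU_mem_gen A) (hu.memQ i j))
    · rw [scal_apply, Matrix.mul_diagonal, coef_apply, ← Algebra.smul_def]
      exact Submodule.smul_mem _ _ h
  · rw [euler, hP, hQ, contract_add, contract_add, contract_coef_right]
    have h1 := contract_odU_mem A hu.memP hu.memQ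
    have h2 := contract_mem (coef_mul_mem A hu.memQ) (coef_mul_mem A hu.memP)
    have h3 := mul_mem_fil (odU_mem_gen A) hu.mem
    convert add_mem (add_mem h1 h2) h3 using 1
    rw [euler, mul_sub, mul_smul_comm, Nat.cast_succ, add_smul, one_smul]
    abel

theorem rP_algebraMap (c : ℂ) : rP (algebraMap ℂ (U n) c) = 0 := by
  rw [rP, cP_algebraMap, sub_self]

theorem eulerProp (k : ℕ) : ∀ u ∈ fil n (k + 1), EulerProp k u := by
  induction k with
  | zero =>
    intro u hu
    -- Because of the shift in `fil`, degree zero means scalars and the error must vanish exactly.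
    change u ∈ gen n ^ 0 at hu
    rw [pow_zero] at hu
    obtain ⟨c, rfl⟩ := Submodule.mem_one.mp hu
    have h0 : contract (0 : Matrix (Fin n) (Fin n) (U n)) 0 = 0 := by simp [contract]
    refine ⟨fun i j => ?_, fun i j => ?_, ?_⟩
    · rw [rP_algebraMap]; exact zero_mem _
    · rw [cQ_algebraMap, map_zero]; exact zero_mem _
    · rw [euler, rP_algebraMap, cQ_algebraMap, map_zero, h0, Nat.cast_zero, zero_smul, sub_zero]
      exact zero_mem _
  | succ k ih =>
    intro u hu
    change u ∈ gen n ^ (k + 1) at hu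
    rw [pow_succ'] at hu
    induction hu using Submodule.mul_induction_on' with
    | mem_mul_mem g hg v hv =>
      obtain ⟨c, A, B, rfl⟩ := exists_of_mem_gen hg
      rw [add_mul, add_mul]
      exact ((ih v hv).algebraMap_mul hv c).add
        (((ih v hv).evU_mul hv A).add ((ih v hv).odU_mul hv B))
    | add x _ y _ hx hy => exact hx.add hy

/-! ### Invariants of the Cartan subalgebra -/

/-- The even elements of `U(q(n))` commuting with the odd Cartan subalgebra. -/
structure Inv (z : U n) : Prop where
  even : parity n z = z
  comm : ∀ a : Fin n → ℂ, odU n (Matrix.diagonal a) * z = z * odU n (Matrix.diagonal a)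

theorem Inv.par_rP {z : U n} (hz : Inv z) : par n (rP z) = rP z := by
  rw [rP, map_sub, ← (parity_components z).1, par_scal, hz.even]

theorem Inv.par_cQ {z : U n} (hz : Inv z) : par n (cQ z) = -cQ z := by
  rw [← neg_eq_iff_eq_neg, ← (parity_components z).2, hz.even]

theorem coef_diagonal_mul_apply (a : Fin n → ℂ) (X : Matrix (Fin n) (Fin n) (U n)) (i j : Fin n) :
    (coef n (Matrix.diagonal a) * X) i j = a i • X i j := by
  rw [coef, AlgHom.mapMatrix_apply, Matrix.diagonal_map (map_zero _), Matrix.diagonal_mul,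
    Algebra.smul_def]
  rfl

theorem mul_coef_diagonal_apply (a : Fin n → ℂ) (X : Matrix (Fin n) (Fin n) (U n)) (i j : Fin n) :
    (X * coef n (Matrix.diagonal a)) i j = a j • X i j := by
  rw [coef, AlgHom.mapMatrix_apply, Matrix.diagonal_map (map_zero _), Matrix.mul_diagonal,
    Algebra.smul_def, Algebra.commutes]
  rfl

theorem mul_scal_apply (u : U n) (X : Matrix (Fin n) (Fin n) (U n)) (i j : Fin n) :
    (X * scal n u) i j = X i j * u := by
  rw [scal_apply, Matrix.mul_diagonal]

/-- This is the `P` component of the coproduct of `H z = z H`; the contribution of `1 ⊗ z` cancels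
by the relation itself. -/
theorem Inv.odU_mul_rP {z : U n} (hz : Inv z) (a : Fin n → ℂ) (i j : Fin n) :
    odU n (Matrix.diagonal a) * rP z i j =
      rP z i j * odU n (Matrix.diagonal a) + (a i + a j) • cQ z i j := by
  have h := congrFun₂ (congrArg cP (hz.comm a)) i j
  rw [cP_mul, cP_mul, cP_odU, cQ_odU, par_coef, hz.par_cQ, mul_neg, cP_eq, mul_add, add_mul,
    ← scal_mul, ← scal_mul, hz.comm] at h
  simp only [Matrix.add_apply, Matrix.neg_apply, scal_mul_apply, mul_scal_apply,
    coef_diagonal_mul_apply, mul_coef_diagonal_apply] at h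
  rw [add_smul]
  generalize odU n (Matrix.diagonal a) * rP z i j = x at h ⊢
  generalize rP z i j * odU n (Matrix.diagonal a) = y at h ⊢
  generalize a i • cQ z i j = s at h ⊢
  generalize a j • cQ z i j = t at h ⊢
  have h' : x = x + scal n (z * odU n (Matrix.diagonal a)) i j + -s +
      (s - scal n (z * odU n (Matrix.diagonal a)) i j) := by abel
  rw [h', h]
  abel

theorem Inv.odU_mul_cQ {z : U n} (hz : Inv z) (a : Fin n → ℂ) (i j : Fin n) :
    odU n (Matrix.diagonal a) * cQ z i j =
      -(cQ z i j * odU n (Matrix.diagonal a)) + (a j - a i) • rP z i j := by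
  have h := congrFun₂ (congrArg cQ (hz.comm a)) i j
  rw [cQ_mul, cQ_mul, cP_odU, cQ_odU, cP_eq, map_add, hz.par_rP, par_scal, par_scal, hz.even,
    parity_odU, map_neg, mul_neg, mul_add, add_mul] at h
  simp only [Matrix.add_apply, Matrix.neg_apply, scal_mul_apply, mul_scal_apply,
    coef_diagonal_mul_apply, mul_coef_diagonal_apply] at h
  -- The part `1 ⊗ z` is scalar, hence visible only for `i = j`, where `a i` and `a j` agree.
  have hs : coef n (Matrix.diagonal a) i j * z = a j • scal n z i j := by
    rw [← mul_scal_apply, coef_diagonal_mul_apply]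
    by_cases hij : i = j
    · rw [hij]
    · rw [scal_apply, Matrix.diagonal_apply_ne _ hij, smul_zero, smul_zero]
  rw [hs] at h
  rw [sub_smul]
  generalize odU n (Matrix.diagonal a) * cQ z i j = x at h ⊢
  generalize cQ z i j * odU n (Matrix.diagonal a) = y at h ⊢
  generalize a i • rP z i j = s at h ⊢
  generalize a j • rP z i j = t at h ⊢
  generalize a j • scal n z i j = r at h
  have h' : x = x + (s + r) - (s + r) := by abel
  rw [h', h]
  abel

/-- Taking complex square roots entrywise makes every even Cartan element the square of an odd one,
so relations with the odd Cartan part imply those with the even part. -/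
theorem exists_odU_sq (h : Fin n → ℂ) :
    ∃ a : Fin n → ℂ, (∀ i, a i * a i = h i) ∧
      evU n (Matrix.diagonal h) = odU n (Matrix.diagonal a) * odU n (Matrix.diagonal a) := by
  choose a ha using fun i => IsAlgClosed.exists_eq_mul_self (h i)
  refine ⟨a, fun i => (ha i).symm, ?_⟩
  rw [odU_mul_self, Matrix.diagonal_mul_diagonal]
  congr 2
  exact funext ha

/-- Two passes through a square root of `h` give the factor `(a i + a j) * (a j - a i) = h j - h i`:
the entry has weight `δ_j - δ_i`, opposite to that of the `(i, j)` matrix unit. -/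
theorem Inv.evU_mul_rP {z : U n} (hz : Inv z) (h : Fin n → ℂ) (i j : Fin n) :
    evU n (Matrix.diagonal h) * rP z i j =
      rP z i j * evU n (Matrix.diagonal h) + (h j - h i) • rP z i j := by
  obtain ⟨a, haa, ha⟩ := exists_odU_sq h
  rw [ha, mul_assoc, hz.odU_mul_rP, mul_add, ← mul_assoc, hz.odU_mul_rP, mul_smul_comm,
    hz.odU_mul_cQ, add_mul, smul_mul_assoc, smul_add, smul_neg, smul_smul, mul_assoc, ← haa, ← haa]
  rw [show (a i + a j) * (a j - a i) = a j * a j - a i * a i by ring]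
  abel

theorem Inv.evU_mul_cQ {z : U n} (hz : Inv z) (h : Fin n → ℂ) (i j : Fin n) :
    evU n (Matrix.diagonal h) * cQ z i j =
      cQ z i j * evU n (Matrix.diagonal h) + (h j - h i) • cQ z i j := by
  obtain ⟨a, haa, ha⟩ := exists_odU_sq h
  rw [ha, mul_assoc, hz.odU_mul_cQ, mul_add, mul_neg, ← mul_assoc, hz.odU_mul_cQ, mul_smul_comm,
    hz.odU_mul_rP, add_mul, smul_mul_assoc, smul_add, smul_smul, neg_mul, mul_assoc, ← haa, ← haa]
  rw [show (a j - a i) * (a i + a j) = a j * a j - a i * a i by ring]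
  abel

/-! ### Cartan elements against matrix units -/

theorem diagonal_mul_single (a : Fin n → ℂ) (i j : Fin n) :
    Matrix.diagonal a * Matrix.single i j (1 : ℂ) = a i • Matrix.single i j 1 := by
  ext k l
  by_cases h : i = k
  · subst h; simp [Matrix.diagonal_mul]
  · simp [Matrix.diagonal_mul, h]

theorem single_mul_diagonal (a : Fin n → ℂ) (i j : Fin n) :
    Matrix.single i j (1 : ℂ) * Matrix.diagonal a = a j • Matrix.single i j 1 := by
  ext k l
  by_cases h : j = l
  · subst h; simp [Matrix.mul_diagonal, mul_comm]
  · simp [Matrix.mul_diagonal, h]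

theorem odU_diagonal_mul_evU (a : Fin n → ℂ) (i j : Fin n) :
    odU n (Matrix.diagonal a) * evU n (Matrix.single i j 1) =
      evU n (Matrix.single i j 1) * odU n (Matrix.diagonal a) +
        (a i - a j) • odU n (Matrix.single i j 1) := by
  rw [odU_mul_evU, diagonal_mul_single, single_mul_diagonal, ← sub_smul, map_smul]

theorem odU_diagonal_mul_odU (a : Fin n → ℂ) (i j : Fin n) :
    odU n (Matrix.diagonal a) * odU n (Matrix.single i j 1) =
      -(odU n (Matrix.single i j 1) * odU n (Matrix.diagonal a)) +
        (a i + a j) • evU n (Matrix.single i j 1) := by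
  rw [odU_mul_odU, diagonal_mul_single, single_mul_diagonal, ← add_smul, map_smul]

theorem evU_diagonal_mul_evU (a : Fin n → ℂ) (i j : Fin n) :
    evU n (Matrix.diagonal a) * evU n (Matrix.single i j 1) =
      evU n (Matrix.single i j 1) * evU n (Matrix.diagonal a) +
        (a i - a j) • evU n (Matrix.single i j 1) := by
  rw [evU_mul_evU, diagonal_mul_single, single_mul_diagonal, ← sub_smul, map_smul]

theorem evU_diagonal_mul_odU (a : Fin n → ℂ) (i j : Fin n) :
    evU n (Matrix.diagonal a) * odU n (Matrix.single i j 1) =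
      odU n (Matrix.single i j 1) * evU n (Matrix.diagonal a) +
        (a i - a j) • odU n (Matrix.single i j 1) := by
  rw [evU_mul_odU, diagonal_mul_single, single_mul_diagonal, ← sub_smul, map_smul]

theorem Inv.euler_eq {z : U n} (hz : Inv z) : euler z =
    ∑ i, ∑ j, (evU n (Matrix.single i j 1) * rP z i j - odU n (Matrix.single i j 1) * cQ z i j) := by
  rw [euler, hz.par_cQ, contract]
  simp only [Matrix.neg_apply, mul_neg, sub_eq_add_neg]

/-- Each `(i, j)` summand commutes with `H` separately: the cross terms with coefficients `a i + a
j` and `a i - a j` cancel between its even and odd halves. This keeps the induction of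
`Inv.functional_eq` within the invariants. -/
theorem Inv.euler {z : U n} (hz : Inv z) : Inv (euler z) where
  even := by
    rw [hz.euler_eq]
    simp only [map_sum, map_sub, map_mul, parity_evU, parity_odU, ← par_apply, hz.par_rP, hz.par_cQ,
      Matrix.neg_apply, neg_mul_neg]
  comm a := by
    rw [hz.euler_eq]
    simp only [Finset.mul_sum, Finset.sum_mul]
    refine Finset.sum_congr rfl fun i _ => Finset.sum_congr rfl fun j _ => ?_
    rw [mul_sub, ← mul_assoc, ← mul_assoc, odU_diagonal_mul_evU, odU_diagonal_mul_odU, add_mul,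
      add_mul, neg_mul, mul_assoc, mul_assoc, hz.odU_mul_rP, hz.odU_mul_cQ]
    simp only [mul_add, mul_neg, mul_smul_comm, smul_mul_assoc, sub_mul, mul_assoc, sub_smul,
      add_smul, mul_sub, add_mul]
    abel

/-- The commutation relation behind the invariance under a cyclic shift. -/
theorem Inv.comm_shift {z : U n} (hz : Inv z) (a : Fin n → ℂ) (i j : Fin n) :
    odU n (Matrix.diagonal a) * (rP z i j * evU n (Matrix.single i j 1) +
        cQ z i j * odU n (Matrix.single i j 1)) =
      (rP z i j * evU n (Matrix.single i j 1) + cQ z i j * odU n (Matrix.single i j 1)) *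
        odU n (Matrix.diagonal a) := by
  rw [mul_add, ← mul_assoc, ← mul_assoc, hz.odU_mul_rP, hz.odU_mul_cQ, add_mul, add_mul, neg_mul,
    mul_assoc, mul_assoc, odU_diagonal_mul_evU, odU_diagonal_mul_odU]
  simp only [mul_add, mul_neg, mul_smul_comm, smul_mul_assoc, add_mul, mul_assoc, sub_smul,
    add_smul, mul_sub, sub_mul]
  abel

theorem aug_euler {z : U n} (hz : Inv z) : aug n (euler z) = 0 := by
  rw [hz.euler_eq]
  simp

/-- A functional that vanishes on the elements `euler z` is a multiple of the augmentation on the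
invariants of the Cartan subalgebra. -/
theorem Inv.functional_eq (F : U n →ₗ[ℂ] ℂ) (hF : ∀ z, Inv z → F (Queer.euler z) = 0) {z : U n}
    (hz : Inv z) : F z = aug n z * F 1 := by
  obtain ⟨k, hk⟩ := exists_mem_fil z
  induction k generalizing z with
  | zero => rw [(Submodule.mem_bot ℂ).mp hk, map_zero, map_zero, zero_mul]
  | succ k ih =>
    rcases k with _ | k
    · change z ∈ gen n ^ 0 at hk
      rw [pow_zero] at hk
      obtain ⟨c, rfl⟩ := Submodule.mem_one.mp hk
      rw [AlgHom.commutes, Algebra.algebraMap_eq_smul_one, map_smul, smul_eq_mul]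
      rfl
    · have h1 := (eulerProp _ z hk).mem
      -- The difference is invariant and of lower degree. Both `F` and `aug` kill `euler z`, so the
      -- induction hypothesis for the difference is the claim for `z` times `-(k + 1)`.
      have h2 : Inv (Queer.euler z - ((k + 1 : ℕ) : ℂ) • z) :=
        { even := by rw [map_sub, map_smul, hz.euler.even, hz.even]
          comm := fun a => by
            rw [mul_sub, sub_mul, hz.euler.comm, mul_smul_comm, smul_mul_assoc, hz.comm] }
      have h3 := ih h2 h1
      rw [map_sub, map_sub, map_smul, map_smul, hF z hz, aug_euler hz, zero_sub, zero_sub,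
        smul_eq_mul, smul_eq_mul, neg_mul, neg_inj, mul_assoc] at h3
      exact mul_left_cancel₀ (Nat.cast_ne_zero.mpr k.succ_ne_zero) h3

/-! ### Homogeneous elements and evaluation of weights -/

theorem mem_grU_false {u : U n} : u ∈ grU n false ↔ parity n u = u := by
  simp [grU, LinearMap.mem_eqLocus]

theorem mem_grU_true {u : U n} : u ∈ grU n true ↔ parity n u = -u := by
  simp [grU, LinearMap.mem_eqLocus]

theorem evU_mem_grU (A : Matrix (Fin n) (Fin n) ℂ) : evU n A ∈ grU n false :=
  mem_grU_false.mpr (parity_evU A)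

theorem odU_mem_grU (A : Matrix (Fin n) (Fin n) ℂ) : odU n A ∈ grU n true :=
  mem_grU_true.mpr (parity_odU A)

theorem Weight.val_zero (h : Fin n → ℂ) : Weight.val (0 : Weight n) h = 0 := by
  simp [Weight.val]

theorem Weight.val_add (lam mu : Weight n) (h : Fin n → ℂ) :
    (lam + mu).val h = lam.val h + mu.val h := by
  simp [Weight.val, add_mul, Finset.sum_add_distrib]

theorem Weight.val_single (i : Fin n) (h : Fin n → ℂ) :
    Weight.val (Pi.single i 1 : Weight n) h = h i := by
  simp [Weight.val, Pi.single_apply]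

theorem Weight.val_neg (mu : Weight n) (h : Fin n → ℂ) : (-mu).val h = -mu.val h := by
  simp [Weight.val]

theorem Weight.val_sub (lam mu : Weight n) (h : Fin n → ℂ) :
    (lam - mu).val h = lam.val h - mu.val h := by
  rw [sub_eq_add_neg, Weight.val_add, Weight.val_neg, sub_eq_add_neg]

/-! ### Supertraces on weight spaces -/

section Trace

variable {M : Type} [AddCommGroup M] [Module ℂ M] [Module (U n) M] [IsScalarTower ℂ (U n) M]

theorem mem_weightSpace {gr : Bool → Submodule ℂ M} {mu : Weight n} {ε : Bool} {x : M} :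
    x ∈ weightSpace n gr mu ε ↔
      x ∈ gr ε ∧ ∀ h, evU n (Matrix.diagonal h) • x = mu.val h • x := by
  simp only [weightSpace, Submodule.mem_inf, Submodule.mem_iInf, LinearMap.mem_eqLocus]
  rfl

/-- A projection onto a subspace. -/
noncomputable def projOn (S : Submodule ℂ M) : M →ₗ[ℂ] S :=
  (S.subtype.exists_leftInverse_of_injective S.ker_subtype).choose

theorem projOn_coe (S : Submodule ℂ M) (s : S) : projOn S s = s :=
  LinearMap.congr_fun (S.subtype.exists_leftInverse_of_injective S.ker_subtype).choose_spec s

/-- The trace of the compression of the action of `u` to a subspace. -/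
noncomputable def trOn (n : ℕ) {M : Type} [AddCommGroup M] [Module ℂ M] [Module (U n) M]
    [IsScalarTower ℂ (U n) M] (S : Submodule ℂ M) : U n →ₗ[ℂ] ℂ where
  toFun u := LinearMap.trace ℂ S (projOn S ∘ₗ Module.toModuleEnd ℂ (S := U n) M u ∘ₗ S.subtype)
  map_add' u v := by
    rw [← map_add]
    congr 1
    ext s
    simp [add_smul]
  map_smul' c u := by
    rw [RingHom.id_apply, ← map_smul]
    congr 1
    ext s
    simp

theorem trOn_congr {S : Submodule ℂ M} {u v : U n} (h : ∀ s ∈ S, u • s = v • s) :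
    trOn n S u = trOn n S v := by
  change LinearMap.trace ℂ S _ = LinearMap.trace ℂ S _
  congr 1
  ext s
  simp [h s s.2]

theorem trOn_one (S : Submodule ℂ M) [FiniteDimensional ℂ S] : trOn n S 1 = Module.finrank ℂ S := by
  rw [← LinearMap.trace_id ℂ S]
  change LinearMap.trace ℂ S _ = _
  congr 1
  ext s
  simp [projOn_coe]

/-- The action of `u` as a map between two subspaces. -/
noncomputable def resOn {S S' : Submodule ℂ M} (u : U n) (h : ∀ s ∈ S, u • s ∈ S') :
    S →ₗ[ℂ] S' :=
  LinearMap.restrict (Module.toModuleEnd ℂ (S := U n) M u) h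

theorem trOn_eq_resOn {S : Submodule ℂ M} (u : U n) (h : ∀ s ∈ S, u • s ∈ S) :
    trOn n S u = LinearMap.trace ℂ S (resOn u h) := by
  change LinearMap.trace ℂ S _ = _
  congr 1
  ext s
  have := projOn_coe S ⟨u • (s : M), h s s.2⟩
  exact congrArg Subtype.val this

/-- Stability makes the compressions genuine restrictions, so cyclicity holds even between different
subspaces. It is used to change both parity and weight. -/
theorem trOn_mul_comm {S S' : Submodule ℂ M} [FiniteDimensional ℂ S] [FiniteDimensional ℂ S']
    {x y : U n} (hy : ∀ s ∈ S, y • s ∈ S') (hx : ∀ s ∈ S', x • s ∈ S) :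
    trOn n S (x * y) = trOn n S' (y * x) := by
  have hxy : ∀ s ∈ S, (x * y) • s ∈ S := fun s hs => by
    rw [mul_smul]; exact hx _ (hy s hs)
  have hyx : ∀ s ∈ S', (y * x) • s ∈ S' := fun s hs => by
    rw [mul_smul]; exact hy _ (hx s hs)
  rw [trOn_eq_resOn _ hxy, trOn_eq_resOn _ hyx]
  have h1 : resOn (x * y) hxy = resOn x hx ∘ₗ resOn y hy := by
    ext s; exact mul_smul x y (s : M)
  have h2 : resOn (y * x) hyx = resOn y hy ∘ₗ resOn x hx := by
    ext s; exact mul_smul y x (s : M)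
  rw [h1, h2, LinearMap.trace_comp_comm']

theorem trOn_eq_zero_of_sq {S : Submodule ℂ M} [FiniteDimensional ℂ S] {u : U n}
    (h : ∀ s ∈ S, u • s ∈ S) (h2 : ∀ s ∈ S, (u * u) • s = 0) : trOn n S u = 0 := by
  rw [trOn_eq_resOn u h]
  have hnil : IsNilpotent (resOn u h) := by
    refine ⟨2, ?_⟩
    rw [sq]
    ext s
    have := h2 s s.2
    rw [mul_smul] at this
    exact this
  exact (LinearMap.isNilpotent_trace_of_isNilpotent hnil).eq_zero

/-- Compatibility of the action of `U(q(n))` with the parity decomposition. -/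
def GradedAction (n : ℕ) {M : Type} [AddCommGroup M] [Module ℂ M] [Module (U n) M]
    (gr : Bool → Submodule ℂ M) : Prop :=
  ∀ (δ ε : Bool) (u : U n) (x : M), u ∈ grU n δ → x ∈ gr ε → u • x ∈ gr (xor δ ε)

theorem smul_mem_weightSpace {gr : Bool → Submodule ℂ M} (hgr : GradedAction n gr) {u : U n}
    {δ ε ε' : Bool} {mu nu : Weight n} {c : (Fin n → ℂ) → ℂ} (hu : u ∈ grU n δ)
    (hc : ∀ h, evU n (Matrix.diagonal h) * u = u * evU n (Matrix.diagonal h) + c h • u)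
    (hnu : ∀ h, nu.val h = mu.val h + c h) (hε : xor δ ε = ε') :
    ∀ x ∈ weightSpace n gr mu ε, u • x ∈ weightSpace n gr nu ε' := by
  intro x hx
  rw [mem_weightSpace] at hx ⊢
  refine ⟨hε ▸ hgr δ ε u x hu hx.1, fun h => ?_⟩
  rw [← mul_smul, hc, add_smul, mul_smul, hx.2, hnu, add_smul, smul_assoc, smul_comm u]

theorem odU_diagonal_smul_mem {gr : Bool → Submodule ℂ M} (hgr : GradedAction n gr)
    (a : Fin n → ℂ) (mu : Weight n) (ε : Bool) :
    ∀ x ∈ weightSpace n gr mu ε, odU n (Matrix.diagonal a) • x ∈ weightSpace n gr mu (!ε) := by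
  refine smul_mem_weightSpace (c := 0) hgr (odU_mem_grU _) (fun h => ?_) (by simp) (by simp)
  rw [evU_mul_odU, Matrix.diagonal_mul_diagonal, Matrix.diagonal_mul_diagonal]
  simp [mul_comm]

theorem odU_diagonal_sq_smul {gr : Bool → Submodule ℂ M} (a : Fin n → ℂ) {mu : Weight n} {ε : Bool}
    {x : M} (hx : x ∈ weightSpace n gr mu ε) :
    (odU n (Matrix.diagonal a) * odU n (Matrix.diagonal a)) • x = mu.val (a * a) • x := by
  rw [odU_mul_self, Matrix.diagonal_mul_diagonal]
  exact (mem_weightSpace.mp hx).2 _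

/-- The supertrace on the weight space of weight `mu`. -/
noncomputable def strOn (n : ℕ) {M : Type} [AddCommGroup M] [Module ℂ M] [Module (U n) M]
    [IsScalarTower ℂ (U n) M] (gr : Bool → Submodule ℂ M) (mu : Weight n) : U n →ₗ[ℂ] ℂ :=
  trOn n (weightSpace n gr mu false) - trOn n (weightSpace n gr mu true)

theorem strOn_one (gr : Bool → Submodule ℂ M)
    (hfin : ∀ mu ε, FiniteDimensional ℂ (weightSpace n gr mu ε)) (mu : Weight n) :
    strOn n gr mu 1 = (sch n gr mu : ℂ) := by
  rw [strOn, LinearMap.sub_apply, trOn_one, trOn_one, sch]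
  push_cast
  rfl

/-- An operator on a weight space commuting with an odd Cartan element whose square is nonzero has
supertrace zero. -/
theorem strOn_eq_zero_of_comm {gr : Bool → Submodule ℂ M} (hgr : GradedAction n gr)
    (hfin : ∀ mu ε, FiniteDimensional ℂ (weightSpace n gr mu ε)) 
    {mu : Weight n} {a : Fin n → ℂ} (ha : mu.val (a * a) ≠ 0) {w : U n}
    (hw : ∀ ε, ∀ x ∈ weightSpace n gr mu ε, w • x ∈ weightSpace n gr mu ε)
    (hcomm : odU n (Matrix.diagonal a) * w = w * odU n (Matrix.diagonal a)) :
    strOn n gr mu w = 0 := by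
  have hH := odU_diagonal_smul_mem hgr a mu
  set H := odU n (Matrix.diagonal a)
  have key : ∀ ε, trOn n (weightSpace n gr mu ε) (mu.val (a * a) • w) =
      trOn n (weightSpace n gr mu ε) (H * (H * w)) := fun ε => trOn_congr fun s hs => by
    rw [← mul_assoc, mul_smul, odU_diagonal_sq_smul a (hw ε s hs), smul_assoc]
  -- Replace `w` by a multiple of `H * (H * w)`. Cycling the outer `H` passes to the other parity,
  -- and commutation with `w` restores the same product.
  have key2 : trOn n (weightSpace n gr mu false) (H * (H * w)) =
      trOn n (weightSpace n gr mu true) (H * (H * w)) := by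
    rw [trOn_mul_comm (S' := weightSpace n gr mu true)
      (fun s hs => by rw [mul_smul]; exact hH false _ (hw _ s hs)) (by simpa using hH true), mul_assoc, hcomm]
  rw [← key, ← key, map_smul, map_smul] at key2
  rw [strOn, LinearMap.sub_apply, sub_eq_zero]
  exact smul_right_injective ℂ ha key2

/-- The supercharacter vanishes at nonzero weights. -/
theorem sch_eq_zero {gr : Bool → Submodule ℂ M} (hgr : GradedAction n gr)
    (hfin : ∀ mu ε, FiniteDimensional ℂ (weightSpace n gr mu ε)) 
    {mu : Weight n} (hmu : mu ≠ 0) : sch n gr mu = 0 := by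
  obtain ⟨i, hi⟩ := Function.ne_iff.mp hmu
  -- For the `i`-th unit vector the square of `H` acts by `mu i`, and `w = 1` computes the
  -- superdimension.
  have h := strOn_eq_zero_of_comm hgr hfin (mu := mu) (a := Pi.single i 1) (w := 1) (by
    simpa [Weight.val, Pi.single_apply] using hi) (by simp) (by simp)
  rw [strOn_one gr hfin] at h
  exact_mod_cast h

/-- On weight `0` the Cartan element in the even half acts by zero. In the odd half `H` and `Q`
anticommute when `i = j`, and `H` has square zero there, so `H * Q` has square zero and trace zero.
-/
theorem strOn_zero_euler_diag {gr : Bool → Submodule ℂ M} (hgr : GradedAction n gr)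
    (hfin : ∀ mu ε, FiniteDimensional ℂ (weightSpace n gr mu ε)) 
    {z : U n} (hz : Inv z) (i : Fin n) :
    strOn n gr 0 (evU n (Matrix.single i i 1) * rP z i i -
      odU n (Matrix.single i i 1) * cQ z i i) = 0 := by
  have hP : ∀ ε, ∀ x ∈ weightSpace n gr 0 ε, rP z i i • x ∈ weightSpace n gr 0 ε := fun ε =>
    smul_mem_weightSpace hgr (mem_grU_false.mpr (by rw [← par_apply, hz.par_rP]))
      (fun h => hz.evU_mul_rP h i i) (by simp) (by simp)
  have hQ : ∀ ε, ∀ x ∈ weightSpace n gr 0 ε, cQ z i i • x ∈ weightSpace n gr 0 (!ε) := fun ε =>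
    smul_mem_weightSpace hgr
      (mem_grU_true.mpr (by rw [← par_apply, hz.par_cQ, Matrix.neg_apply]))
      (fun h => hz.evU_mul_cQ h i i) (by simp) (by simp)
  have hsingle : Matrix.single i i (1 : ℂ) = Matrix.diagonal (Pi.single i 1) :=
    (Matrix.diagonal_single i 1).symm
  rw [hsingle]
  have h1 : ∀ ε, trOn n (weightSpace n gr 0 ε)
      (evU n (Matrix.diagonal (Pi.single i 1)) * rP z i i) = 0 := fun ε => by
    rw [← map_zero (trOn n (weightSpace n gr 0 ε))]
    refine trOn_congr fun s hs => ?_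
    rw [mul_smul, (mem_weightSpace.mp (hP ε s hs)).2, Weight.val_zero, zero_smul, zero_smul]
  have hH := odU_diagonal_smul_mem hgr (Pi.single i 1) 0
  have hcomm := hz.odU_mul_cQ (Pi.single i 1) i i
  rw [sub_self, zero_smul, add_zero] at hcomm
  have h2 : ∀ ε, trOn n (weightSpace n gr 0 ε)
      (odU n (Matrix.diagonal (Pi.single i 1)) * cQ z i i) = 0 := fun ε => by
    refine trOn_eq_zero_of_sq (fun s hs => ?_) fun s hs => ?_
    · rw [mul_smul]
      simpa using hH _ _ (hQ ε s hs)
    · nth_rewrite 1 [hcomm]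
      rw [neg_mul, mul_assoc, ← mul_assoc (odU n _), neg_smul, mul_smul, mul_smul,
        odU_diagonal_sq_smul _ (hQ ε s hs), Weight.val_zero, zero_smul, smul_zero, neg_zero]
  rw [strOn, LinearMap.sub_apply, map_sub, map_sub, h1, h1, h2, h2]
  simp

/-- The term factors through the nonzero weight `nu = δ_j - δ_i`. Moved cyclically to that weight
space, it commutes with all odd Cartan elements by `Inv.comm_shift`. -/
theorem strOn_zero_euler_offDiag {gr : Bool → Submodule ℂ M} (hgr : GradedAction n gr)
    (hfin : ∀ mu ε, FiniteDimensional ℂ (weightSpace n gr mu ε)) 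
    {z : U n} (hz : Inv z) {i j : Fin n} (hij : i ≠ j) :
    strOn n gr 0 (evU n (Matrix.single i j 1) * rP z i j -
      odU n (Matrix.single i j 1) * cQ z i j) = 0 := by
  set nu : Weight n := Pi.single j 1 - Pi.single i 1 with hnu
  have hval : ∀ h, nu.val h = h j - h i := fun h => by
    rw [hnu, Weight.val_sub, Weight.val_single, Weight.val_single]
  have hP : ∀ ε, ∀ x ∈ weightSpace n gr 0 ε, rP z i j • x ∈ weightSpace n gr nu ε := fun ε =>
    smul_mem_weightSpace hgr (mem_grU_false.mpr (by rw [← par_apply, hz.par_rP]))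
      (fun h => hz.evU_mul_rP h i j) (fun h => by rw [hval, Weight.val_zero, zero_add])
      (by simp)
  have hQ : ∀ ε, ∀ x ∈ weightSpace n gr 0 ε, cQ z i j • x ∈ weightSpace n gr nu (!ε) := fun ε =>
    smul_mem_weightSpace hgr
      (mem_grU_true.mpr (by rw [← par_apply, hz.par_cQ, Matrix.neg_apply]))
      (fun h => hz.evU_mul_cQ h i j) (fun h => by rw [hval, Weight.val_zero, zero_add])
      (by simp)
  have hE : ∀ ε, ∀ x ∈ weightSpace n gr nu ε,
      evU n (Matrix.single i j 1) • x ∈ weightSpace n gr 0 ε := fun ε =>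
    smul_mem_weightSpace hgr (evU_mem_grU _) (fun h => evU_diagonal_mul_evU h i j)
      (fun h => by rw [hval, Weight.val_zero]; ring) (by simp)
  have hO : ∀ ε, ∀ x ∈ weightSpace n gr nu ε,
      odU n (Matrix.single i j 1) • x ∈ weightSpace n gr 0 (!ε) := fun ε =>
    smul_mem_weightSpace hgr (odU_mem_grU _) (fun h => evU_diagonal_mul_odU h i j)
      (fun h => by rw [hval, Weight.val_zero]; ring) (by simp)
  -- The `j`-th coordinate of `nu` is 1, so the square of this odd Cartan element is the identity on
  -- weight `nu`.
  have hw := strOn_eq_zero_of_comm hgr hfin (mu := nu) (a := Pi.single j 1)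
    (by rw [hval]; simp [hij]) (fun ε x hx => by
      rw [add_smul, mul_smul, mul_smul]
      exact add_mem (hP ε _ (hE ε x hx)) (by simpa using hQ _ _ (hO ε x hx)))
    (hz.comm_shift _ i j)
  have h1 : ∀ ε, trOn n (weightSpace n gr 0 ε) (evU n (Matrix.single i j 1) * rP z i j) =
      trOn n (weightSpace n gr nu ε) (rP z i j * evU n (Matrix.single i j 1)) := fun ε =>
    trOn_mul_comm (hP ε) (hE ε)
  -- Cycling a product of two odd factors flips the parity of the space, which turns the minus sign
  -- of the Euler term into the plus sign of `hw`.
  have h2 : ∀ ε, trOn n (weightSpace n gr 0 ε) (odU n (Matrix.single i j 1) * cQ z i j) =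
      trOn n (weightSpace n gr nu (!ε)) (cQ z i j * odU n (Matrix.single i j 1)) := fun ε =>
    trOn_mul_comm (hQ ε) (by simpa using hO (!ε))
  rw [strOn, LinearMap.sub_apply, map_add, map_add] at hw
  rw [strOn, LinearMap.sub_apply, map_sub, map_sub, h1, h1, h2, h2, Bool.not_false, Bool.not_true]
  rw [← hw]
  abel

/-- The supertrace of an invariant of the Cartan subalgebra on the zero weight space. -/
theorem strOn_zero {gr : Bool → Submodule ℂ M} (hgr : GradedAction n gr)
    (hfin : ∀ mu ε, FiniteDimensional ℂ (weightSpace n gr mu ε)) {z : U n} (hz : Inv z) :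
    strOn n gr 0 z = aug n z * sch n gr 0 := by
  rw [← strOn_one gr hfin]
  refine hz.functional_eq _ fun z hz => ?_
  rw [hz.euler_eq, map_sum]
  refine Finset.sum_eq_zero fun i _ => ?_
  rw [map_sum]
  refine Finset.sum_eq_zero fun j _ => ?_
  by_cases hij : i = j
  · subst hij
    exact strOn_zero_euler_diag hgr hfin hz i
  · exact strOn_zero_euler_offDiag hgr hfin hz hij

end Trace

/-! ### Weights of highest weight modules -/

section HighestWeight

variable {M : Type} [AddCommGroup M] [Module ℂ M] [Module (U n) M]

/-- Vectors obtained by applying `k` negative root vectors to a vector of `E`, with their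
weights. -/
inductive Descendant (lam : Weight n) (E : Submodule ℂ M) : ℕ → Weight n → M → Prop
  | base {x : M} (hx : x ∈ E) : Descendant lam E 0 lam x
  | even {k : ℕ} {nu : Weight n} {x : M} {i j : Fin n} (hij : j < i)
      (hx : Descendant lam E k nu x) :
      Descendant lam E (k + 1) (nu - (Pi.single j 1 - Pi.single i 1))
        (evU n (Matrix.single i j 1) • x)
  | odd {k : ℕ} {nu : Weight n} {x : M} {i j : Fin n} (hij : j < i)
      (hx : Descendant lam E k nu x) :
      Descendant lam E (k + 1) (nu - (Pi.single j 1 - Pi.single i 1))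
        (odU n (Matrix.single i j 1) • x)

variable {lam : Weight n} {E : Submodule ℂ M}

theorem Descendant.sub_mem_posCone {k : ℕ} {nu : Weight n} {x : M}
    (hx : Descendant lam E k nu x) : lam - nu ∈ posCone n := by
  induction hx with
  | base hx => rw [sub_self]; exact zero_mem _
  | even hij _ ih =>
    rw [sub_sub_eq_add_sub, add_sub_right_comm]
    exact add_mem ih (AddSubmonoid.subset_closure ⟨_, _, hij, rfl⟩)
  | odd hij _ ih =>
    rw [sub_sub_eq_add_sub, add_sub_right_comm]
    exact add_mem ih (AddSubmonoid.subset_closure ⟨_, _, hij, rfl⟩)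

/-- Each negative root vector raises the functional with values `0, 1, 2, …` by `i - j ≥ 1`. Hence
the weight alone bounds the number of factors. -/
theorem Descendant.height {k : ℕ} {nu : Weight n} {x : M} (hx : Descendant lam E k nu x) :
    ∃ m : ℕ, k ≤ m ∧ nu.val (fun i => (i : ℂ)) = lam.val (fun i => (i : ℂ)) + m := by
  have step : ∀ {k : ℕ} {nu : Weight n} {i j : Fin n}, j < i →
      (∃ m : ℕ, k ≤ m ∧ nu.val (fun i => (i : ℂ)) = lam.val (fun i => (i : ℂ)) + m) →
      ∃ m : ℕ, k + 1 ≤ m ∧ Weight.val (nu - (Pi.single j 1 - Pi.single i 1)) (fun i => (i : ℂ)) =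
        lam.val (fun i => (i : ℂ)) + m := by
    rintro k nu i j hij ⟨m, hm, h⟩
    have hij' : (j : ℕ) < i := hij
    refine ⟨m + (i - j), by omega, ?_⟩
    rw [Weight.val_sub, Weight.val_sub, Weight.val_single, Weight.val_single, h]
    push_cast [Nat.cast_sub hij'.le]
    ring
  induction hx with
  | base hx => exact ⟨0, le_rfl, by simp⟩
  | even hij _ ih => exact step hij ih
  | odd hij _ ih => exact step hij ih

/-- The span of the descendants of weight `nu`. -/
def descSpan (lam : Weight n) (E : Submodule ℂ M) (nu : Weight n) : Submodule ℂ M :=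
  Submodule.span ℂ {x | ∃ k, Descendant lam E k nu x}

/-- The span of the descendants of length `k`. -/
def lengthSpan (lam : Weight n) (E : Submodule ℂ M) (k : ℕ) : Submodule ℂ M :=
  Submodule.span ℂ {x | ∃ nu, Descendant lam E k nu x}

/-- The span of all descendants. -/
def allSpan (lam : Weight n) (E : Submodule ℂ M) : Submodule ℂ M :=
  Submodule.span ℂ {x | ∃ k nu, Descendant lam E k nu x}

theorem allSpan_le_iSup : allSpan lam E ≤ ⨆ nu, descSpan lam E nu := by
  refine Submodule.span_le.mpr ?_
  rintro x ⟨k, nu, hx⟩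
  exact Submodule.mem_iSup_of_mem nu (Submodule.subset_span ⟨k, hx⟩)

variable [IsScalarTower ℂ (U n) M]

/-- The action of an element of `U(q(n))` as a linear endomorphism. -/
noncomputable abbrev act (M : Type) [AddCommGroup M] [Module ℂ M] [Module (U n) M]
    [IsScalarTower ℂ (U n) M] (u : U n) : Module.End ℂ M :=
  Module.toModuleEnd ℂ (S := U n) M u

theorem act_apply (u : U n) (x : M) : act M u x = u • x := rfl

/-- The singular vectors of weight `lam`. -/
def singular (M : Type) [AddCommGroup M] [Module ℂ M] [Module (U n) M]
    [IsScalarTower ℂ (U n) M] (lam : Weight n) : Submodule ℂ M where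
  carrier := {x | (∀ i j : Fin n, i < j → evU n (Matrix.single i j 1) • x = 0 ∧
      odU n (Matrix.single i j 1) • x = 0) ∧
    ∀ h, evU n (Matrix.diagonal h) • x = lam.val h • x}
  zero_mem' := by simp
  add_mem' := fun {x y} hx hy =>
    ⟨fun i j hij => by simp [(hx.1 i j hij).1, (hx.1 i j hij).2, (hy.1 i j hij).1,
      (hy.1 i j hij).2], fun h => by rw [smul_add, smul_add, hx.2, hy.2]⟩
  smul_mem' := fun c x hx =>
    ⟨fun i j hij => by simp [smul_comm _ c x, (hx.1 i j hij).1, (hx.1 i j hij).2],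
      fun h => by rw [smul_comm _ c x, smul_comm _ c x, hx.2]⟩

/-- The odd Cartan subalgebra normalises the positive root vectors and commutes with the even Cartan
subalgebra. -/
theorem odU_diagonal_smul_mem_singular (a : Fin n → ℂ) {lam : Weight n} {x : M}
    (hx : x ∈ singular M lam) : odU n (Matrix.diagonal a) • x ∈ singular M lam := by
  refine ⟨fun i j hij => ⟨?_, ?_⟩, fun h => ?_⟩
  · rw [← mul_smul, ← sub_eq_iff_eq_add.mpr (odU_diagonal_mul_evU a i j), sub_smul, mul_smul,
      (hx.1 i j hij).1, smul_assoc, (hx.1 i j hij).2, smul_zero, smul_zero, sub_zero]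
  · have h' := congrArg (· • x) (odU_diagonal_mul_odU a i j)
    simp only [mul_smul, add_smul, neg_smul, (hx.1 i j hij).2, smul_assoc, (hx.1 i j hij).1,
      smul_zero, add_zero] at h'
    exact neg_eq_zero.mp h'.symm
  · rw [← mul_smul, evU_mul_odU, Matrix.diagonal_mul_diagonal, Matrix.diagonal_mul_diagonal]
    simp only [mul_comm, sub_self, map_zero, add_zero]
    rw [mul_smul, hx.2, smul_comm]

/-- A singular vector lies in a finite-dimensional space of singular vectors stable under the odd
Cartan subalgebra. -/
theorem exists_stable {lam : Weight n} {v : M} (hv : v ∈ singular M lam) :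
    ∃ E : Submodule ℂ M, FiniteDimensional ℂ E ∧ v ∈ E ∧ E ≤ singular M lam ∧
      ∀ a, ∀ x ∈ E, odU n (Matrix.diagonal a) • x ∈ E := by
  have key : ∀ s : Finset (Fin n), ∃ E : Submodule ℂ M, FiniteDimensional ℂ E ∧ v ∈ E ∧
      E ≤ singular M lam ∧
        ∀ i ∈ s, ∀ x ∈ E, odU n (Matrix.diagonal (Pi.single i 1)) • x ∈ E := by
    intro s
    induction s using Finset.induction_on with
    | empty =>
      refine ⟨Submodule.span ℂ {v}, inferInstance, Submodule.mem_span_singleton_self v, ?_, by simp⟩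
      rwa [Submodule.span_singleton_le_iff_mem]
    | insert k s _ ih =>
      obtain ⟨E, hE, hvE, hET, hs⟩ := ih
      -- Adjoining `H_k E` once suffices: `H_k` squares to an even Cartan element, a scalar on
      -- singular vectors, and `H_i` anticommutes with `H_k` up to such scalars.
      refine ⟨E ⊔ E.map (act M (odU n (Matrix.diagonal (Pi.single k 1)))), inferInstance,
        Submodule.mem_sup_left hvE, sup_le hET ?_, ?_⟩
      · rintro _ ⟨x, hx, rfl⟩
        exact odU_diagonal_smul_mem_singular _ (hET hx)
      · intro i hi x hx
        obtain ⟨y, hy, _, ⟨w, hw, rfl⟩, rfl⟩ := Submodule.mem_sup.mp hx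
        rw [smul_add, act_apply, ← mul_smul]
        rcases Finset.mem_insert.mp hi with rfl | hi
        · refine add_mem (Submodule.mem_sup_right ⟨y, hy, rfl⟩) (Submodule.mem_sup_left ?_)
          rw [odU_mul_self, Matrix.diagonal_mul_diagonal, (hET hw).2]
          exact E.smul_mem _ hw
        · refine add_mem (Submodule.mem_sup_left (hs i hi y hy)) ?_
          rw [odU_mul_odU, Matrix.diagonal_mul_diagonal, Matrix.diagonal_mul_diagonal,
            Matrix.diagonal_add, add_smul, neg_smul, mul_smul, (hET hw).2]
          exact add_mem (neg_mem (Submodule.mem_sup_right ⟨_, hs i hi w hw, rfl⟩))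
            (Submodule.mem_sup_left (E.smul_mem _ hw))
  obtain ⟨E, hE, hvE, hET, hs⟩ := key Finset.univ
  refine ⟨E, hE, hvE, hET, fun a x hx => ?_⟩
  have ha : Matrix.diagonal a = ∑ i, a i • Matrix.diagonal (Pi.single i (1 : ℂ)) := by
    ext k l
    rw [Matrix.sum_apply]
    by_cases hkl : k = l
    · subst hkl
      simp [Pi.single_apply]
    · simp [hkl]
  rw [ha, map_sum, Finset.sum_smul]
  refine sum_mem fun i _ => ?_
  rw [map_smul, smul_assoc]
  exact E.smul_mem _ (hs i (Finset.mem_univ i) x hx)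

theorem Descendant.weight (hET : E ≤ singular M lam) {k : ℕ} {nu : Weight n} {x : M}
    (hx : Descendant lam E k nu x) (h : Fin n → ℂ) :
    evU n (Matrix.diagonal h) • x = nu.val h • x := by
  induction hx with
  | base hx => exact (hET hx).2 h
  | even hij _ ih =>
    rw [← mul_smul, evU_diagonal_mul_evU, add_smul, mul_smul, ih, smul_comm _ (Weight.val _ h),
      smul_assoc, ← add_smul, Weight.val_sub, Weight.val_sub, Weight.val_single,
      Weight.val_single]
    congr 1
    ring
  | odd hij _ ih =>
    rw [← mul_smul, evU_diagonal_mul_odU, add_smul, mul_smul, ih, smul_comm _ (Weight.val _ h),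
      smul_assoc, ← add_smul, Weight.val_sub, Weight.val_sub, Weight.val_single,
      Weight.val_single]
    congr 1
    ring

theorem lengthSpan_finite (hE : FiniteDimensional ℂ E) (k : ℕ) :
    FiniteDimensional ℂ (lengthSpan lam E k) := by
  induction k with
  | zero =>
    refine Submodule.finiteDimensional_of_le (S₂ := E) (Submodule.span_le.mpr ?_)
    rintro x ⟨nu, hx⟩
    cases hx with
    | base hx => exact hx
  | succ k ih =>
    refine Submodule.finiteDimensional_of_le (S₂ := ⨆ p : Fin n × Fin n,
      (lengthSpan lam E k).map (act M (evU n (Matrix.single p.1 p.2 1))) ⊔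
        (lengthSpan lam E k).map (act M (odU n (Matrix.single p.1 p.2 1))))
      (Submodule.span_le.mpr ?_)
    rintro x ⟨nu, hx⟩
    cases hx with
    | @even _ _ y i j hij hy =>
      exact Submodule.mem_iSup_of_mem (i, j)
        (Submodule.mem_sup_left ⟨y, Submodule.subset_span ⟨_, hy⟩, rfl⟩)
    | @odd _ _ y i j hij hy =>
      exact Submodule.mem_iSup_of_mem (i, j)
        (Submodule.mem_sup_right ⟨y, Submodule.subset_span ⟨_, hy⟩, rfl⟩)

theorem evU_smul_mem_allSpan {i j : Fin n} (hij : j < i) {x : M} (hx : x ∈ allSpan lam E) :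
    evU n (Matrix.single i j 1) • x ∈ allSpan lam E := by
  change x ∈ (allSpan lam E).comap (act M (evU n (Matrix.single i j 1)))
  refine Submodule.span_le.mpr ?_ hx
  rintro x ⟨k, nu, hx⟩
  exact Submodule.subset_span ⟨_, _, hx.even hij⟩

theorem odU_smul_mem_allSpan {i j : Fin n} (hij : j < i) {x : M} (hx : x ∈ allSpan lam E) :
    odU n (Matrix.single i j 1) • x ∈ allSpan lam E := by
  change x ∈ (allSpan lam E).comap (act M (odU n (Matrix.single i j 1)))
  refine Submodule.span_le.mpr ?_ hx
  rintro x ⟨k, nu, hx⟩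
  exact Submodule.subset_span ⟨_, _, hx.odd hij⟩

/-- Move the generator past the outermost negative root vector. The bracket is again a generator
acting on a shorter descendant, so the induction must treat all `A`, even and odd, together. -/
theorem Descendant.smul_mem_allSpan (hET : E ≤ singular M lam)
    (hEs : ∀ a, ∀ x ∈ E, odU n (Matrix.diagonal a) • x ∈ E) {k : ℕ} {nu : Weight n} {x : M}
    (hx : Descendant lam E k nu x) :
    ∀ A, evU n A • x ∈ allSpan lam E ∧ odU n A • x ∈ allSpan lam E := by
  induction hx with
  | @base x hx =>
    have hdesc : ∀ y ∈ E, y ∈ allSpan lam E := fun y hy =>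
      Submodule.subset_span ⟨0, lam, Descendant.base hy⟩
    have hsingle : ∀ i j : Fin n, evU n (Matrix.single i j 1) • x ∈ allSpan lam E ∧
        odU n (Matrix.single i j 1) • x ∈ allSpan lam E := fun i j => by
      rcases lt_trichotomy i j with hij | rfl | hij
      · rw [((hET hx).1 i j hij).1, ((hET hx).1 i j hij).2]
        exact ⟨zero_mem _, zero_mem _⟩
      · rw [← Matrix.diagonal_single, (hET hx).2]
        exact ⟨Submodule.smul_mem _ _ (hdesc x hx), hdesc _ (hEs _ x hx)⟩
      · exact ⟨evU_smul_mem_allSpan hij (hdesc x hx), odU_smul_mem_allSpan hij (hdesc x hx)⟩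
    have hlin : ∀ (A : Matrix (Fin n) (Fin n) ℂ) (f : Matrix (Fin n) (Fin n) ℂ →ₗ[ℂ] U n),
        (∀ i j, f (Matrix.single i j 1) • x ∈ allSpan lam E) → f A • x ∈ allSpan lam E := by
      intro A f hf
      rw [Matrix.matrix_eq_sum_single A]
      simp only [map_sum, Finset.sum_smul]
      refine sum_mem fun i _ => sum_mem fun j _ => ?_
      rw [← mul_one (A i j), ← smul_eq_mul, ← Matrix.smul_single, map_smul, smul_assoc]
      exact Submodule.smul_mem _ _ (hf i j)
    exact fun A => ⟨hlin A _ fun i j => (hsingle i j).1, hlin A _ fun i j => (hsingle i j).2⟩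
  | even hij _ ih =>
    intro A
    rw [← mul_smul, ← mul_smul, evU_mul_evU, odU_mul_evU, add_smul, add_smul, mul_smul, mul_smul]
    exact ⟨add_mem (evU_smul_mem_allSpan hij (ih _).1) (ih _).1,
      add_mem (evU_smul_mem_allSpan hij (ih _).2) (ih _).2⟩
  | odd hij _ ih =>
    intro A
    rw [← mul_smul, ← mul_smul, evU_mul_odU, odU_mul_odU, add_smul, add_smul, neg_smul, mul_smul,
      mul_smul]
    exact ⟨add_mem (odU_smul_mem_allSpan hij (ih _).1) (ih _).2,
      add_mem (neg_mem (odU_smul_mem_allSpan hij (ih _).2)) (ih _).1⟩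

theorem smul_mem_allSpan (hET : E ≤ singular M lam)
    (hEs : ∀ a, ∀ x ∈ E, odU n (Matrix.diagonal a) • x ∈ E) (u : U n) :
    ∀ x ∈ allSpan lam E, u • x ∈ allSpan lam E := by
  induction u using U.induction with
  | scalar c =>
    intro x hx
    rw [algebraMap_smul]
    exact Submodule.smul_mem _ c hx
  | even A =>
    intro x hx
    change x ∈ (allSpan lam E).comap (act M (evU n A))
    refine Submodule.span_le.mpr ?_ hx
    rintro x ⟨k, nu, hx⟩
    exact (hx.smul_mem_allSpan hET hEs A).1
  | odd A =>
    intro x hx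
    change x ∈ (allSpan lam E).comap (act M (odU n A))
    refine Submodule.span_le.mpr ?_ hx
    rintro x ⟨k, nu, hx⟩
    exact (hx.smul_mem_allSpan hET hEs A).2
  | mul a b ha hb => exact fun x hx => by rw [mul_smul]; exact ha _ (hb x hx)
  | add a b ha hb => exact fun x hx => by rw [add_smul]; exact add_mem (ha x hx) (hb x hx)

/-! ### Weight decomposition of highest weight modules -/

/-- The simultaneous generalised eigenspaces of the even Cartan subalgebra. -/
noncomputable def genWeightSpace (M : Type) [AddCommGroup M] [Module ℂ M] [Module (U n) M]
    [IsScalarTower ℂ (U n) M] (nu : Weight n) : Submodule ℂ M :=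
  ⨅ i, (act M (evU n (Matrix.diagonal (Pi.single i 1)))).maxGenEigenspace (nu i)

theorem mem_genWeightSpace {nu : Weight n} {x : M}
    (hx : ∀ h, evU n (Matrix.diagonal h) • x = nu.val h • x) : x ∈ genWeightSpace M nu := by
  rw [genWeightSpace, Submodule.mem_iInf]
  intro i
  refine Module.End.genEigenspace_le_maximal _ _ 1 (Module.End.mem_eigenspace_iff.mpr ?_)
  rw [act_apply, hx]
  congr 1
  simp [Weight.val, Pi.single_apply]

theorem genWeightSpace_independent : iSupIndep (genWeightSpace (n := n) M) := by
  refine Module.End.independent_iInf_maxGenEigenspace_of_forall_mapsTo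
    (fun i => act M (evU n (Matrix.diagonal (Pi.single i 1)))) fun i j φ => ?_
  refine Module.End.mapsTo_maxGenEigenspace_of_comm ?_ φ
  have h : evU n (Matrix.diagonal (Pi.single j 1)) * evU n (Matrix.diagonal (Pi.single i 1)) =
      evU n (Matrix.diagonal (Pi.single i 1)) * evU n (Matrix.diagonal (Pi.single j 1)) := by
    rw [evU_mul_evU, Matrix.diagonal_mul_diagonal, Matrix.diagonal_mul_diagonal]
    simp [mul_comm]
  exact (map_mul (Module.toModuleEnd ℂ M) _ _).symm.trans
    ((congrArg _ h).trans (map_mul (Module.toModuleEnd ℂ M) _ _))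

/-- Independence forces the components outside `i` to vanish. This reduces spanning by all
descendants to spanning by those of a single weight. -/
theorem mem_of_mem_iSup {ι R N : Type*} [Ring R] [AddCommGroup N] [Module R N]
    {V S : ι → Submodule R N} (hV : iSupIndep V) (hS : ∀ i, S i ≤ V i) {i : ι} {x : N}
    (hx : x ∈ V i) (hx' : x ∈ ⨆ i, S i) : x ∈ S i := by
  rw [iSup_split_single S i] at hx'
  obtain ⟨s, hs, t, ht, rfl⟩ := Submodule.mem_sup.mp hx'
  have h1 : t ∈ V i := by simpa using sub_mem hx (hS i hs)
  have h2 : t ∈ ⨆ j, ⨆ (_ : j ≠ i), V j := (iSup₂_mono fun j _ => hS j) ht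
  rw [Submodule.disjoint_def.mp (hV i) t h1 h2, add_zero]
  exact hs

theorem weightSpace_le_descSpan (hET : E ≤ singular M lam)
    (hEs : ∀ a, ∀ x ∈ E, odU n (Matrix.diagonal a) • x ∈ E) {v : M} (hv : v ∈ E)
    (hgen : ∀ x : M, ∃ u : U n, u • v = x) (gr : Bool → Submodule ℂ M) (mu : Weight n)
    (ε : Bool) : weightSpace n gr mu ε ≤ descSpan lam E mu := by
  intro x hx
  refine mem_of_mem_iSup genWeightSpace_independent (fun nu => ?_)
    (mem_genWeightSpace (mem_weightSpace.mp hx).2) (allSpan_le_iSup ?_)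
  · refine Submodule.span_le.mpr ?_
    rintro y ⟨k, hy⟩
    exact mem_genWeightSpace (hy.weight hET)
  · obtain ⟨u, rfl⟩ := hgen x
    exact smul_mem_allSpan hET hEs u v (Submodule.subset_span ⟨0, lam, Descendant.base hv⟩)

/-- The weight spaces of a highest weight module are finite-dimensional. -/
theorem weightSpace_finite {v : M} (hv : v ∈ singular M lam)
    (hgen : ∀ x : M, ∃ u : U n, u • v = x) (gr : Bool → Submodule ℂ M) (mu : Weight n)
    (ε : Bool) : FiniteDimensional ℂ (weightSpace n gr mu ε) := by
  obtain ⟨E, hE, hvE, hET, hEs⟩ := exists_stable hv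
  have hle := weightSpace_le_descSpan hET hEs hvE hgen gr mu ε
  -- A bound on the length of descendants of weight `mu` places their span in a finite sum of the
  -- spaces `lengthSpan`; the height of any one of them serves as `N`.
  suffices h : ∃ N : ℕ, ∀ k x, Descendant lam E k mu x → k ≤ N by
    obtain ⟨N, hN⟩ := h
    have := lengthSpan_finite (lam := lam) hE
    refine Submodule.finiteDimensional_of_le
      (S₂ := ⨆ k : Fin (N + 1), lengthSpan lam E k) (hle.trans (Submodule.span_le.mpr ?_))
    rintro x ⟨k, hx⟩
    exact Submodule.mem_iSup_of_mem (⟨k, Nat.lt_succ_of_le (hN k x hx)⟩ : Fin (N + 1))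
      (Submodule.subset_span ⟨mu, hx⟩)
  by_cases h : ∃ k x, Descendant lam E k mu x
  · obtain ⟨k, x, hx⟩ := h
    obtain ⟨N, -, hN⟩ := hx.height
    refine ⟨N, fun k' x' hx' => ?_⟩
    obtain ⟨N', hle', hN'⟩ := hx'.height
    rw [hN, add_right_inj, Nat.cast_inj] at hN'
    exact hN' ▸ hle'
  · push Not at h
    exact ⟨0, fun k x hx => absurd hx (h k x)⟩

/-- The weights of a highest weight module are below the highest weight. -/
theorem sub_mem_posCone {v : M} (hv : v ∈ singular M lam)
    (hgen : ∀ x : M, ∃ u : U n, u • v = x) {gr : Bool → Submodule ℂ M} {mu : Weight n}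
    {ε : Bool} (h : weightSpace n gr mu ε ≠ ⊥) : lam - mu ∈ posCone n := by
  obtain ⟨E, hE, hvE, hET, hEs⟩ := exists_stable hv
  by_contra hmu
  refine h (le_bot_iff.mp ((weightSpace_le_descSpan hET hEs hvE hgen gr mu ε).trans ?_))
  refine Submodule.span_le.mpr ?_
  rintro x ⟨k, hx⟩
  exact absurd hx.sub_mem_posCone hmu

end HighestWeight

/-! ### The irreducible modules `L(lam)` -/

theorem mul_mem_grU {δ ε : Bool} {u v : U n} (hu : u ∈ grU n δ) (hv : v ∈ grU n ε) :
    u * v ∈ grU n (xor δ ε) := by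
  cases δ <;> cases ε <;>
    simp only [mem_grU_false, mem_grU_true, Bool.xor_false, Bool.xor_true, Bool.not_false,
      Bool.not_true] at hu hv ⊢ <;>
    simp [hu, hv]

/-- The two parts are the averages over the parity involution; `aug` is parity invariant and so
kills the odd one. -/
theorem exists_homogeneous (u : U n) : ∃ u₀ ∈ grU n false, ∃ u₁ ∈ grU n true, u = u₀ + u₁ ∧
    aug n u₁ = 0 := by
  refine ⟨(2⁻¹ : ℂ) • (u + parity n u), ?_, (2⁻¹ : ℂ) • (u - parity n u), ?_, ?_, ?_⟩
  · rw [mem_grU_false, map_smul, map_add, parity_parity, add_comm]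
  · rw [mem_grU_true, map_smul, map_sub, parity_parity, ← smul_neg, neg_sub]
  · rw [← smul_add, add_add_sub_cancel, ← two_smul ℂ u, smul_smul, inv_mul_cancel₀ two_ne_zero,
      one_smul]
  · rw [map_smul, map_sub, aug_parity, sub_self, smul_zero]

variable {lam : Weight n} {W : Submodule ℂ (Fin n → ℂ)}

theorem gradedAction_grVerma : GradedAction n (grVerma lam W) := by
  rintro δ ε u _ hu ⟨y, hy, rfl⟩
  exact ⟨u * y, mul_mem_grU hu hy, rfl⟩

theorem gradedAction_grL : GradedAction n (grL lam W) := by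
  rintro δ ε u _ hu ⟨y, hy, rfl⟩
  exact ⟨u • y, gradedAction_grVerma δ ε u y hu hy, rfl⟩

theorem isGraded_of_le {M : Type} [AddCommGroup M] [Module ℂ M] [Module (U n) M]
    [IsScalarTower ℂ (U n) M] {gr : Bool → Submodule ℂ M} {N : Submodule (U n) M}
    (h : ∀ x ∈ N, x ∈ (N.restrictScalars ℂ ⊓ gr false) ⊔ (N.restrictScalars ℂ ⊓ gr true)) :
    IsGraded gr N :=
  le_antisymm h (sup_le inf_le_left inf_le_left)

theorem mem_homogeneous {M : Type} [AddCommGroup M] [Module ℂ M] [Module (U n) M]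
    [IsScalarTower ℂ (U n) M] {gr : Bool → Submodule ℂ M} {N : Submodule (U n) M} {x : M}
    (hx : x ∈ N) {ε : Bool} (hε : x ∈ gr ε) :
    x ∈ (N.restrictScalars ℂ ⊓ gr false) ⊔ (N.restrictScalars ℂ ⊓ gr true) := by
  cases ε
  · exact Submodule.mem_sup_left ⟨hx, hε⟩
  · exact Submodule.mem_sup_right ⟨hx, hε⟩

theorem homogeneous_mono {M : Type} [AddCommGroup M] [Module ℂ M] [Module (U n) M]
    [IsScalarTower ℂ (U n) M] {gr : Bool → Submodule ℂ M} {N N' : Submodule (U n) M}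
    (hN : IsGraded gr N) (hle : N ≤ N') {x : M} (hx : x ∈ N) :
    x ∈ (N'.restrictScalars ℂ ⊓ gr false) ⊔ (N'.restrictScalars ℂ ⊓ gr true) := by
  have hx' : x ∈ N.restrictScalars ℂ := hx
  rw [hN] at hx'
  have hle' : N.restrictScalars ℂ ≤ N'.restrictScalars ℂ := hle
  exact sup_le_sup (inf_le_inf_right _ hle') (inf_le_inf_right _ hle') hx'

theorem isGraded_maxSub : IsGraded (grVerma lam W) (maxSub lam W) := by
  refine isGraded_of_le fun x hx => ?_
  rw [maxSub, sSup_eq_iSup'] at hx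
  induction hx using Submodule.iSup_induction' with
  | mem N x hx => exact homogeneous_mono N.2.1 (le_sSup N.2) hx
  | zero => exact zero_mem _
  | add x y _ _ hx hy => exact add_mem hx hy

/-- The quotient map `U(q(n)) → L(lam)`. -/
noncomputable def toL (lam : Weight n) (W : Submodule ℂ (Fin n → ℂ)) : U n →ₗ[U n] L lam W :=
  (maxSub lam W).mkQ ∘ₗ (vermaIdeal lam W).mkQ

theorem toL_eq (u : U n) : toL lam W u = u • toL lam W 1 := by
  rw [← map_smul, smul_eq_mul, mul_one]

theorem toL_surjective : Function.Surjective (toL lam W) :=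
  (Submodule.mkQ_surjective _).comp (Submodule.mkQ_surjective _)

theorem exists_smul_toL_one (x : L lam W) : ∃ u : U n, u • toL lam W 1 = x := by
  obtain ⟨u, rfl⟩ := toL_surjective x
  exact ⟨u, (toL_eq u).symm⟩

theorem toL_eq_zero {u : U n} (hu : u ∈ vermaIdeal lam W) : toL lam W u = 0 := by
  rw [toL, LinearMap.comp_apply,
    show (vermaIdeal lam W).mkQ u = 0 from (Submodule.Quotient.mk_eq_zero _).mpr hu, map_zero]

theorem toL_one_mem_singular : toL lam W 1 ∈ singular (L lam W) lam := by
  refine ⟨fun i j hij => ⟨?_, ?_⟩, fun h => ?_⟩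
  · rw [← toL_eq]
    exact toL_eq_zero (Submodule.subset_span (Or.inl (Or.inl (Or.inl ⟨i, j, hij, rfl⟩))))
  · rw [← toL_eq]
    exact toL_eq_zero (Submodule.subset_span (Or.inl (Or.inl (Or.inr ⟨i, j, hij, rfl⟩))))
  · have : toL lam W (evU n (Matrix.diagonal h) - algebraMap ℂ (U n) (lam.val h)) = 0 :=
      toL_eq_zero (Submodule.subset_span (Or.inl (Or.inr ⟨h, rfl⟩)))
    rw [toL_eq, sub_smul, sub_eq_zero, algebraMap_smul] at this
    exact this

/-- Every nonzero homogeneous vector generates `L(lam)`. -/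
theorem exists_smul_eq {ε : Bool} {x : L lam W} (hx : x ∈ grL lam W ε) (hx0 : x ≠ 0)
    (y : L lam W) : ∃ u : U n, u • x = y := by
  obtain ⟨v, hv, rfl⟩ := hx
  -- This submodule is graded because `v` is homogeneous. Were it proper it would lie in `maxSub`,
  -- and the image of `v` would be zero.
  set N : Submodule (U n) (Verma lam W) := Submodule.span (U n) {v} ⊔ maxSub lam W
  have hvN : v ∈ N := Submodule.mem_sup_left (Submodule.mem_span_singleton_self v)
  have hgr : IsGraded (grVerma lam W) N := by
    refine isGraded_of_le fun w hw => ?_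
    obtain ⟨s, hs, m, hm, rfl⟩ := Submodule.mem_sup.mp hw
    obtain ⟨a, rfl⟩ := Submodule.mem_span_singleton.mp hs
    obtain ⟨a₀, h₀, a₁, h₁, rfl, -⟩ := exists_homogeneous a
    refine add_mem ?_ (homogeneous_mono isGraded_maxSub le_sup_right hm)
    rw [add_smul]
    exact add_mem
      (mem_homogeneous (N.smul_mem _ hvN) (gradedAction_grVerma false ε a₀ v h₀ hv))
      (mem_homogeneous (N.smul_mem _ hvN) (gradedAction_grVerma true ε a₁ v h₁ hv))
  have htop : N = ⊤ := by
    by_contra htop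
    have hle : N ≤ maxSub lam W := le_sSup ⟨hgr, htop⟩
    exact hx0 ((Submodule.Quotient.mk_eq_zero _).mpr (hle hvN))
  obtain ⟨w, rfl⟩ := Submodule.mkQ_surjective _ y
  have hw : w ∈ N := htop ▸ Submodule.mem_top
  obtain ⟨s, hs, m, hm, rfl⟩ := Submodule.mem_sup.mp hw
  obtain ⟨a, rfl⟩ := Submodule.mem_span_singleton.mp hs
  refine ⟨a, ?_⟩
  rw [map_add, show (maxSub lam W).mkQ m = 0 from (Submodule.Quotient.mk_eq_zero _).mpr hm,
    add_zero]
  rfl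

theorem weightSpace_grL_finite (mu : Weight n) (ε : Bool) :
    FiniteDimensional ℂ (weightSpace n (grL lam W) mu ε) :=
  weightSpace_finite toL_one_mem_singular exists_smul_toL_one _ mu ε

/-! ### The center and the trivial central character -/

theorem mem_Z {z : U n} (hz : z ∈ Z n) : (∀ u, z * u = u * z) ∧ parity n z = z :=
  ⟨fun u => (Subalgebra.mem_center_iff.mp hz.1 u).symm, hz.2⟩

theorem inv_of_mem_Z {z : U n} (hz : z ∈ Z n) : Inv z :=
  ⟨(mem_Z hz).2, fun _ => ((mem_Z hz).1 _).symm⟩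

/-- If the supercharacter of `L(lam)` is nonzero at the weight `0`, then the center acts on
`L(lam)` through the augmentation. -/
theorem central_smul_eq_aug (h0 : sch n (grL lam W) 0 ≠ 0) {z : U n} (hz : z ∈ Z n)
    (x : L lam W) : z • x = aug n z • x := by
  have hfin := weightSpace_grL_finite (lam := lam) (W := W)
  obtain ⟨ε, hε⟩ : ∃ ε, Nontrivial (weightSpace n (grL lam W) 0 ε) := by
    by_contra! h
    refine h0 ?_
    have h1 : ∀ ε, Module.finrank ℂ (weightSpace n (grL lam W) 0 ε) = 0 := fun ε =>
      have := h ε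
      Module.finrank_zero_of_subsingleton
    rw [sch, h1, h1, sub_self]
  have hstab : ∀ s ∈ weightSpace n (grL lam W) 0 ε, z • s ∈ weightSpace n (grL lam W) 0 ε :=
    smul_mem_weightSpace (c := 0) gradedAction_grL (mem_grU_false.mpr (mem_Z hz).2)
      (fun h => by simp [(mem_Z hz).1]) (by simp) (by simp)
  -- An eigenvector inside one parity component is homogeneous, so it generates `L(lam)` and its
  -- eigenvalue is the scalar by which `z` acts everywhere. Computing the supertrace of `z` on
  -- weight `0` in two ways then identifies `c`.
  obtain ⟨c, hc⟩ := Module.End.exists_eigenvalue (resOn z hstab)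
  obtain ⟨s, hs⟩ := hc.exists_hasEigenvector
  have hzs : z • (s : L lam W) = c • (s : L lam W) := congrArg Subtype.val hs.apply_eq_smul
  have hs0 : (s : L lam W) ≠ 0 := fun h => hs.2 (Subtype.ext h)
  have hact : ∀ y : L lam W, z • y = c • y := fun y => by
    obtain ⟨u, rfl⟩ := exists_smul_eq (mem_weightSpace.mp s.2).1 hs0 y
    rw [← mul_smul, (mem_Z hz).1, mul_smul, hzs, smul_comm]
  have h1 : strOn n (grL lam W) 0 z = strOn n (grL lam W) 0 (c • 1) := by
    have h2 : ∀ ε, trOn n (weightSpace n (grL lam W) 0 ε) z =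
        trOn n (weightSpace n (grL lam W) 0 ε) (c • 1) := fun ε =>
      trOn_congr fun s _ => by rw [hact, smul_assoc, one_smul]
    rw [strOn, LinearMap.sub_apply, LinearMap.sub_apply, h2, h2]
  rw [strOn_zero gradedAction_grL hfin (inv_of_mem_Z hz), map_smul, strOn_one _ hfin,
    smul_eq_mul] at h1
  rw [hact, mul_right_cancel₀ (Int.cast_ne_zero.mpr h0) h1]

/-- The kernel of `aug` is a left ideal; it contains the Cartan generators because the highest
weight is `0`. -/
theorem aug_eq_zero_of_mem_vermaIdeal {u : U n} (hu : u ∈ vermaIdeal 0 W) : aug n u = 0 := by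
  change u ∈ (RingHom.ker (aug n) : Submodule (U n) (U n))
  refine Submodule.span_le.mpr ?_ hu
  rintro _ (((⟨i, j, -, rfl⟩ | ⟨i, j, -, rfl⟩) | ⟨h, rfl⟩) | ⟨w, -, rfl⟩)
  · exact aug_evU _
  · exact aug_odU _
  · change aug n _ = 0
    rw [map_sub, incl_ev, aug_evU, Weight.val_zero, map_zero, map_zero, sub_zero]
  · exact aug_odU _

/-- The center acts on the trivial module `L(0)` through the augmentation. -/
theorem central_smul_eq_aug_zero {z : U n} (hz : z ∈ Z n) (x : L 0 W) : z • x = aug n z • x := by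
  -- The image of the augmentation ideal is graded and proper, hence contained in `maxSub`; it
  -- contains the class of `z - aug z`.
  set N : Submodule (U n) (Verma 0 W) :=
    Submodule.map (vermaIdeal 0 W).mkQ (RingHom.ker (aug n) : Submodule (U n) (U n))
  have hgr : IsGraded (grVerma 0 W) N := by
    refine isGraded_of_le ?_
    rintro _ ⟨u, hu, rfl⟩
    obtain ⟨u₀, h₀, u₁, h₁, rfl, haug⟩ := exists_homogeneous u
    have hu' : aug n (u₀ + u₁) = 0 := hu
    rw [map_add, haug, add_zero] at hu'
    rw [map_add]
    exact add_mem (mem_homogeneous (ε := false) ⟨u₀, hu', rfl⟩ ⟨u₀, h₀, rfl⟩)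
      (mem_homogeneous (ε := true) ⟨u₁, haug, rfl⟩ ⟨u₁, h₁, rfl⟩)
  have htop : N ≠ ⊤ := by
    intro htop
    have h1 : (vermaIdeal 0 W).mkQ 1 ∈ N := htop ▸ Submodule.mem_top
    obtain ⟨u, hu, h⟩ := h1
    have h2 := aug_eq_zero_of_mem_vermaIdeal ((Submodule.Quotient.eq _).mp h)
    rw [map_sub, map_one, show aug n u = 0 from hu, zero_sub, neg_eq_zero] at h2
    exact one_ne_zero h2
  have hle : N ≤ maxSub 0 W := le_sSup ⟨hgr, htop⟩
  have hz1 : toL 0 W (z - algebraMap ℂ (U n) (aug n z)) = 0 := by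
    refine (Submodule.Quotient.mk_eq_zero _).mpr (hle ⟨_, ?_, rfl⟩)
    change aug n _ = 0
    rw [map_sub, AlgHom.commutes]
    exact sub_self _
  rw [toL_eq, sub_smul, sub_eq_zero, algebraMap_smul] at hz1
  obtain ⟨u, rfl⟩ := exists_smul_toL_one x
  rw [← mul_smul, (mem_Z hz).1, mul_smul, hz1, smul_comm]

theorem exists_int_of_mem_posCone {mu : Weight n} (h : mu ∈ posCone n) (i : Fin n) :
    ∃ k : ℤ, mu i = k := by
  induction h using AddSubmonoid.closure_induction with
  | mem x hx =>
    obtain ⟨j, k, -, rfl⟩ := hx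
    exact ⟨(Pi.single j 1 - Pi.single k 1 : Fin n → ℤ) i, by simp [Pi.single_apply]⟩
  | zero => exact ⟨0, by simp⟩
  | add x y _ _ hx hy =>
    obtain ⟨a, ha⟩ := hx
    obtain ⟨b, hb⟩ := hy
    exact ⟨a + b, by simp [ha, hb]⟩

/-- If the supercharacter of `L(lam)` is nonzero at the weight `0`, then `lam ⪰ 0`. -/
theorem succeq_zero_of_sch_ne_zero {W : Weight n → Submodule ℂ (Fin n → ℂ)}
    (h0 : sch n (grL lam (W lam)) 0 ≠ 0) : Succeq W lam 0 := by
  refine ⟨⟨(aug n).comp (Z n).val, fun z x => central_smul_eq_aug h0 z.2 x,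
    fun z x => central_smul_eq_aug_zero z.2 x⟩, ?_⟩
  have hne : ∃ ε, weightSpace n (grL lam (W lam)) 0 ε ≠ ⊥ := by
    by_contra! h
    refine h0 ?_
    rw [sch, h, h, sub_self]
  obtain ⟨ε, hε⟩ := hne
  exact sub_mem_posCone toL_one_mem_singular exists_smul_toL_one hε

end Queer

/-! ### The theorem on supercharacters -/

theorem proposition3p2 (n : ℕ) (W : Queer.Weight n → Submodule ℂ (Fin n → ℂ))
    (hW : ∀ lam : Queer.Weight n, Maximal (Queer.IsIsotropic lam) (W lam))
    (lam : Queer.Weight n) :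
    (∀ (mu : Queer.Weight n) (ε : Bool),
      FiniteDimensional ℂ (Queer.weightSpace n (Queer.grL lam (W lam)) mu ε)) ∧
    (∃ c : ℤ, Queer.sch n (Queer.grL lam (W lam)) = Pi.single (0 : Queer.Weight n) c) ∧
    (¬ Queer.Succeq W lam 0 → Queer.sch n (Queer.grL lam (W lam)) = 0) ∧
    ((¬ ∀ i, ∃ k : ℤ, lam i = k) → Queer.sch n (Queer.grL lam (W lam)) = 0) := by
  have hne : ∀ mu, mu ≠ 0 → Queer.sch n (Queer.grL lam (W lam)) mu = 0 := fun mu hmu =>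
    Queer.sch_eq_zero Queer.gradedAction_grL Queer.weightSpace_grL_finite hmu
  have hzero : ¬ Queer.Succeq W lam 0 → Queer.sch n (Queer.grL lam (W lam)) = 0 := by
    intro h
    funext mu
    by_cases hmu : mu = 0
    · subst hmu
      by_contra h0
      exact h (Queer.succeq_zero_of_sch_ne_zero h0)
    · exact hne mu hmu
  refine ⟨Queer.weightSpace_grL_finite, ⟨Queer.sch n (Queer.grL lam (W lam)) 0, ?_⟩, hzero,
    fun h => hzero fun hs => h fun i => ?_⟩
  · funext mu
    by_cases hmu : mu = 0
    · subst hmu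
      rw [Pi.single_eq_same]
    · rw [hne mu hmu, Pi.single_eq_of_ne hmu]
  · simpa using Queer.exists_int_of_mem_posCone hs.2 i
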